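/- Let $T\in(0,\infty)$, $\tau\in(0,T)$, $d\in\{2,3,\dots\}$, $\xi\in\mathbb R^d$, $m\in\mathbb N=\{1,2,\dots\}$, let $(\varepsilon_n)_{n\in\mathbb N}\subseteq(0,\tau]$, and let $(\delta_n)_{n\in\mathbb N}\subseteq\mathbb R$ satisfy $\limsup_{n\to\infty}\delta_n\le 0$ (the value $-\infty$ being allowed). Then there exist infinitely often differentiable and globally bounded functions $\mu\colon\mathbb R^d\to\mathbb R^d$ and $\sigma\colon\mathbb R^d\to\mathbb R^{d\times m}$ such that for every probability space $(\Omega,\mathcal F,\mathbb P)$, every normal filtration $\mathbb F=(\mathbb F_t)_{t\in[0,T]}$ on it (that is, $\mathbb F$ is right-continuous and $\mathbb F_0$ contains every $A\in\mathcal F$ with $\mathbb P(A)=0$), every standard $m$-dimensional $\mathbb F$-Brownian motion $W\colon[0,T]\times\Omega\to\mathbb R^m$ with continuous paths, every continuous $\mathbb F$-adapted stochastic process $X=(X^{(1)},\dots,X^{(d)})\colon[0,T]\times\Omega\to\mathbb R^d$ satisfying for all $t\in[0,T]$ that $$\mathbb P\Big(X_t=\xi+\int_0^t\mu(X_s)\,ds+\int_0^t\sigma(X_s)\,dW_s\Big)=1,$$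 and every $n\in\mathbb N$ it holds that $$\inf_{\substack{a,b\in[0,\tau],\\ b-a\ge\varepsilon_n}}\ \inf_{\substack{u\colon C([0,a]\cup[b,T],\mathbb R^m)\to\mathbb R\\ \text{measurable}}}\mathbb E\Big[\big|X^{(1)}_T-u\big((W_s)_{s\in[0,a]\cup[b,T]}\big)\big|\Big]\ \ge\ \delta_n.$$ Here the stochastic integral is the Itô integral, $C([0,a]\cup[b,T],\mathbb R^m)$ carries the Borel $\sigma$-algebra of uniform convergence, and the expectations take values in $[0,\infty]$. -/

import Mathlib

open MeasureTheory ProbabilityTheory Filter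
open scoped Topology ENNReal NNReal

/-- A filtration `(𝔽_t)_{t ∈ [0,T]}` is *normal* with respect to `P` if it is right-continuous
and every `𝔽_t` (equivalently, `𝔽_0`) contains all events of probability zero. -/
structure IsNormalFiltration {Ω : Type*} {mΩ : MeasurableSpace Ω} {T : ℝ}
    (P : Measure Ω) (𝔽 : Filtration (Set.Icc (0 : ℝ) T) mΩ) : Prop where
  rightContinuous : 𝔽.IsRightContinuous
  null_mem : ∀ A : Set Ω, MeasurableSet A → P A = 0 → ∀ t, MeasurableSet[𝔽 t] A

/-- `W` is a standard `m`-dimensional Brownian motion on `[0,T]` relative to the filtration `𝔽`: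
it has continuous paths, is `𝔽`-adapted, starts in `0`, and for `s ≤ t` the increment `W_t - W_s`
is independent of `𝔽_s` and has independent centred Gaussian components of variance `t - s`. -/
structure IsStandardBrownianMotion {Ω : Type*} {mΩ : MeasurableSpace Ω} {T : ℝ} {m : ℕ}
    (P : Measure Ω) (𝔽 : Filtration (Set.Icc (0 : ℝ) T) mΩ)
    (W : Set.Icc (0 : ℝ) T → Ω → EuclideanSpace ℝ (Fin m)) : Prop where
  continuous : ∀ ω, Continuous fun t => W t ω
  adapted : Adapted 𝔽 W
  start : ∀ t : Set.Icc (0 : ℝ) T, (t : ℝ) = 0 → ∀ᵐ ω ∂P, W t ω = 0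
  indep : ∀ s t, s ≤ t →
    Indep (MeasurableSpace.comap (fun ω => W t ω - W s ω) inferInstance) (𝔽 s) P
  law : ∀ s t : Set.Icc (0 : ℝ) T, s ≤ t →
    HasLaw (fun ω (j : Fin m) => W t ω j - W s ω j)
      (Measure.pi fun _ : Fin m => gaussianReal 0 (Real.toNNReal ((t : ℝ) - (s : ℝ)))) P

/-- Data of a simple (elementary) real-valued integrand
`∑ i, Φ i · 1_{(left i, right i]}` on `[0,T]`, where `Φ i` is bounded and
`𝔽_{left i}`-measurable. -/
structure SimpleIntegrand {Ω : Type*} {mΩ : MeasurableSpace Ω} {T : ℝ}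
    (𝔽 : Filtration (Set.Icc (0 : ℝ) T) mΩ) where
  card : ℕ
  left : Fin card → Set.Icc (0 : ℝ) T
  right : Fin card → Set.Icc (0 : ℝ) T
  left_le_right : ∀ i, left i ≤ right i
  Φ : Fin card → Ω → ℝ
  measurable : ∀ i, Measurable[𝔽 (left i)] (Φ i)
  bounded : ∃ C : ℝ, ∀ i ω, |Φ i ω| ≤ C

namespace SimpleIntegrand

variable {Ω : Type*} {mΩ : MeasurableSpace Ω} {T : ℝ} {𝔽 : Filtration (Set.Icc (0 : ℝ) T) mΩ}

/-- The value at time `s` of the simple integrand. -/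
noncomputable def value (S : SimpleIntegrand 𝔽) (s : Set.Icc (0 : ℝ) T) (ω : Ω) : ℝ :=
  ∑ i, (Set.Ioc (S.left i) (S.right i)).indicator (fun _ => S.Φ i ω) s

/-- The elementary stochastic integral of the simple integrand over `[0,t]`,
`∑ i, Φ i · (B_{right i ∧ t} - B_{left i ∧ t})`. -/
noncomputable def integral (S : SimpleIntegrand 𝔽) (B : Set.Icc (0 : ℝ) T → Ω → ℝ)
    (t : Set.Icc (0 : ℝ) T) (ω : Ω) : ℝ :=
  ∑ i, S.Φ i ω * (B (min (S.right i) t) ω - B (min (S.left i) t) ω)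

end SimpleIntegrand

/-- Lebesgue measure on the time interval `[0,T]`. -/
noncomputable def timeMeasure (T : ℝ) : Measure (Set.Icc (0 : ℝ) T) :=
  (volume : Measure ℝ).comap Subtype.val

/-- `I` is (a version of) the Itô integral `∫_0^t H_s dB_s` of the progressively measurable,
square-integrable process `H` with respect to the real Brownian motion `B`: it is the
`L²(P)`-limit of the elementary integrals of some sequence of simple integrands that converges to
`H` in `L²` on `[0,t] × Ω`. -/
def IsItoIntegral {Ω : Type*} {mΩ : MeasurableSpace Ω} {T : ℝ} (P : Measure Ω)
    (𝔽 : Filtration (Set.Icc (0 : ℝ) T) mΩ) (B H : Set.Icc (0 : ℝ) T → Ω → ℝ)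
    (t : Set.Icc (0 : ℝ) T) (I : Ω → ℝ) : Prop :=
  IsStronglyProgressive 𝔽 H ∧ MemLp I 2 P ∧
    ∃ S : ℕ → SimpleIntegrand 𝔽,
      Tendsto
        (fun k => ∫⁻ ω, (∫⁻ s in Set.Iic t, ‖(S k).value s ω - H s ω‖ₑ ^ 2 ∂(timeMeasure T)) ∂P)
        atTop (𝓝 0) ∧
      Tendsto (fun k => ∫⁻ ω, ‖(S k).integral B t ω - I ω‖ₑ ^ 2 ∂P) atTop (𝓝 0)

/-- `X` is a continuous `𝔽`-adapted process such that, for every `t ∈ [0,T]`, almost surely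
`X_t = ξ + ∫_0^t μ(X_s) ds + ∫_0^t σ(X_s) dW_s`. The `i`-th component of the stochastic integral
is `∑ j, ∫_0^t σ_{ij}(X_s) dW^{(j)}_s`. As `σ` is meant to be bounded here, all its integrands
are square-integrable. -/
structure IsSDESolution {Ω : Type*} {mΩ : MeasurableSpace Ω} {T : ℝ} {d m : ℕ}
    (P : Measure Ω) (𝔽 : Filtration (Set.Icc (0 : ℝ) T) mΩ)
    (W : Set.Icc (0 : ℝ) T → Ω → EuclideanSpace ℝ (Fin m))
    (ξ : EuclideanSpace ℝ (Fin d))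
    (μ : EuclideanSpace ℝ (Fin d) → EuclideanSpace ℝ (Fin d))
    (σ : EuclideanSpace ℝ (Fin d) → Matrix (Fin d) (Fin m) ℝ)
    (X : Set.Icc (0 : ℝ) T → Ω → EuclideanSpace ℝ (Fin d)) : Prop where
  continuous : ∀ ω, Continuous fun t => X t ω
  adapted : Adapted 𝔽 X
  equation : ∀ t : Set.Icc (0 : ℝ) T, ∃ I : Fin d → Fin m → Ω → ℝ,
    (∀ i j, IsItoIntegral P 𝔽 (fun s ω => W s ω j) (fun s ω => σ (X s ω) i j) t (I i j)) ∧
    ∀ᵐ ω ∂P, ∀ i, X t ω i =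
      ξ i + (∫ s in Set.Iic t, μ (X s ω) i ∂(timeMeasure T)) + ∑ j, I i j ω

/-- The set of observation times `[0,a] ∪ [b,T]`, as a subset of `[0,T]`. -/
def observationTimes (T a b : ℝ) : Set (Set.Icc (0 : ℝ) T) :=
  {s | (s : ℝ) ∈ Set.Icc 0 a ∪ Set.Icc b T}

/-! Two coordinates suffice. Put `Y = (X i₀ - ξ i₀) / V` and `Z = X i₁ - ξ i₁`, and let `dY = (1 -
c(Z) ρ(Y))⁻¹ dt` and `dZ = f(Y) dW`, where `ρ` vanishes up to `τ` and `f` vanishes from `τ` on.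
While `Y ≤ τ` the clock `Y` runs at unit speed, so `Y_t = t` on `[0, τ]`; later `Y_t ≥ t`. Hence
`Z_T = ∫_0^τ f(s) dW_s` is Gaussian and `Z` is frozen after `τ`. From then on `Y - c(Z_T) ∫_τ^Y ρ`
grows at unit speed, so `Y_T - c(Z_T) ∫_τ^{Y_T} ρ = T`. This equation gives `c(Z_T)` as a Lipschitz
function of `Y_T` (`solution_readout`, `exists_lipschitz_readout`), so a good approximation of `X
i₀` at time `T` would yield a good approximation of `c(Z_T)`.

The latter is impossible when `W` is unobserved on `(a, b)`. With `p` the midpoint, the bridge `B =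
∫ (½ 1_{(a,p]} - ½ 1_{(p,b]}) dW` is independent of all observations. Write `Z_T = M + N`, where `N`
is the projection onto `B`; an estimator `U` from the observations and `M` are jointly independent
of the symmetric variable `N` (`indepFun_bridge`). Replacing `N` by `-N` and using the triangle
inequality gives `E|c(M+N) - c(M-N)| ≤ 2 E|c(Z_T) - U|` (`lintegral_reflection_le`). Since `f` is
strictly decreasing on `[0, τ]`, `N` has variance bounded below once `b - a ≥ ε n`
(`exists_le_bridge`), and `M` keeps at least half of the variance of `Z_T` (`bridge_le_half`).

On `[k + 1/4, k + 3/4]` the function `c` oscillates with frequency `w k`. If `w k` is large compared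
with the inverse standard deviation of `N`, the left side is at least some `κ k > 0` that depends
neither on the frequency nor on the variance of `N` (`exists_le_lintegral_oscillation`). As `limsup
δ ≤ 0`, each `n` can be assigned a band `K n` with `δ n ≤ A κ (K n)` so that every band serves only
finitely many `n` (`exists_selection`); a finite frequency `w k` then copes with all of these `ε n`
at once. The scale `V = 2 L A` absorbs the constants.

Itô integrals enter only as `L²` limits. By the isometry, `Z_T` is the limit of Wiener integrals of
step functions; these lie in the linear span of the Gaussian process `W`, and the lower bound is
proved for them before passing to the limit. -/

/-! ### Increments of Brownian motion -/

namespace IsStandardBrownianMotion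

variable {Ω : Type*} {mΩ : MeasurableSpace Ω} {T : ℝ} {m : ℕ} {P : Measure Ω}
  {𝔽 : Filtration (Set.Icc (0 : ℝ) T) mΩ} {W : Set.Icc (0 : ℝ) T → Ω → EuclideanSpace ℝ (Fin m)}

lemma measurable_coord (hW : IsStandardBrownianMotion P 𝔽 W) (t : Set.Icc (0 : ℝ) T) (i : Fin m) :
    Measurable[𝔽 t] fun ω => W t ω i :=
  (by fun_prop : Measurable fun x : EuclideanSpace ℝ (Fin m) => x i).comp (hW.adapted t)

lemma hasLaw_increment (hW : IsStandardBrownianMotion P 𝔽 W) {s t : Set.Icc (0 : ℝ) T}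
    (hst : s ≤ t) (i : Fin m) :
    HasLaw (fun ω => W t ω i - W s ω i) (gaussianReal 0 (Real.toNNReal ((t : ℝ) - s))) P :=
  ((measurePreserving_eval (fun _ : Fin m => gaussianReal 0 (Real.toNNReal ((t : ℝ) - s))) i).hasLaw
    ).comp (hW.law s t hst)

lemma memLp_increment (hW : IsStandardBrownianMotion P 𝔽 W) (s t : Set.Icc (0 : ℝ) T) (i : Fin m) :
    MemLp (fun ω => W t ω i - W s ω i) 2 P := by
  rcases le_total s t with h | h
  · exact (hW.hasLaw_increment h i).hasGaussianLaw.memLp_two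
  · convert (hW.hasLaw_increment h i).hasGaussianLaw.memLp_two.neg using 1
    ext ω; simp

lemma indepFun_increment (hW : IsStandardBrownianMotion P 𝔽 W) {s t : Set.Icc (0 : ℝ) T}
    (hst : s ≤ t) {E F : Type*} [MeasurableSpace E] [MeasurableSpace F]
    {g : EuclideanSpace ℝ (Fin m) → E} (hg : Measurable g)
    {G : Ω → F} (hG : Measurable[𝔽 s] G) :
    IndepFun G (fun ω => g (W t ω - W s ω)) P := by
  refine (IndepFun_iff_Indep _ _ _).2 ?_
  refine indep_of_indep_of_le_left (indep_of_indep_of_le_right (hW.indep s t hst).symm ?_) ?_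
  · exact ((hg.comp (comap_measurable _)) :
      Measurable[MeasurableSpace.comap (fun ω => W t ω - W s ω) inferInstance] _).comap_le
  · exact hG.comap_le

lemma integral_increment (hW : IsStandardBrownianMotion P 𝔽 W) {s t : Set.Icc (0 : ℝ) T}
    (hst : s ≤ t) (i : Fin m) : ∫ ω, (W t ω i - W s ω i) ∂P = 0 := by
  rw [(hW.hasLaw_increment hst i).integral_eq, integral_id_gaussianReal]

lemma integral_increment_mul_increment (hW : IsStandardBrownianMotion P 𝔽 W)
    {s t : Set.Icc (0 : ℝ) T} (hst : s ≤ t) (i j : Fin m) :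
    ∫ ω, (W t ω i - W s ω i) * (W t ω j - W s ω j) ∂P = if i = j then (t : ℝ) - s else 0 := by
  have h0 : (0 : ℝ) ≤ (t : ℝ) - s := sub_nonneg.2 hst
  have := (hW.hasLaw_increment hst i).isProbabilityMeasure
  split_ifs with hij
  · subst hij
    have h := (hW.hasLaw_increment hst i).variance_eq
    rw [variance_id_gaussianReal, variance_of_integral_eq_zero
      (hW.memLp_increment s t i).aestronglyMeasurable.aemeasurable
      (hW.integral_increment hst i), Real.coe_toNNReal _ h0] at h
    rw [← h]
    congr with ω
    ring
  · have hind := iIndepFun_pi (μ := fun _ : Fin m => gaussianReal 0 (Real.toNNReal ((t : ℝ) - s)))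
      (X := fun _ x => x) (fun _ => aemeasurable_id)
    have h2 : IndepFun (fun x : Fin m → ℝ => x i) (fun x => x j)
      (Measure.pi fun _ : Fin m => gaussianReal 0 (Real.toNNReal ((t : ℝ) - s))) :=
      hind.indepFun hij
    have h3 := (hW.law s t hst).integral_comp (f := fun x : Fin m → ℝ => x i * x j)
      ((measurable_pi_apply i).mul (measurable_pi_apply j)).aestronglyMeasurable
    have h4 := (hW.law s t hst).integral_comp (f := fun x : Fin m → ℝ => x i)
      (measurable_pi_apply i).aestronglyMeasurable
    refine h3.trans ?_
    rw [h2.integral_fun_mul_eq_mul_integral (measurable_pi_apply i).aestronglyMeasurable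
      (measurable_pi_apply j).aestronglyMeasurable, ← h4]
    simp only [Function.comp_def]
    rw [hW.integral_increment hst i, zero_mul]

lemma integral_mul_increment (hW : IsStandardBrownianMotion P 𝔽 W) {s t : Set.Icc (0 : ℝ) T}
    (hst : s ≤ t) (i : Fin m) {G : Ω → ℝ} (hG : Measurable[𝔽 s] G) :
    ∫ ω, G ω * (W t ω i - W s ω i) ∂P = 0 := by
  have h := hW.indepFun_increment hst
    (g := fun x : EuclideanSpace ℝ (Fin m) => x i) (by fun_prop) hG
  have h2 := h.integral_fun_mul_eq_mul_integral (hG.mono (𝔽.le s) le_rfl).aestronglyMeasurable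
    (hW.memLp_increment s t i).aestronglyMeasurable
  simp only [PiLp.sub_apply] at h2
  rw [h2, hW.integral_increment hst, mul_zero]

lemma integral_mul_increment_mul_increment (hW : IsStandardBrownianMotion P 𝔽 W)
    {s t : Set.Icc (0 : ℝ) T} (hst : s ≤ t) (i j : Fin m) {G : Ω → ℝ} (hG : Measurable[𝔽 s] G) :
    ∫ ω, G ω * ((W t ω i - W s ω i) * (W t ω j - W s ω j)) ∂P =
      (if i = j then (t : ℝ) - s else 0) * ∫ ω, G ω ∂P := by
  have h := hW.indepFun_increment hst
    (g := fun x : EuclideanSpace ℝ (Fin m) => x i * x j) (by fun_prop) hG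
  have h2 := h.integral_fun_mul_eq_mul_integral (hG.mono (𝔽.le s) le_rfl).aestronglyMeasurable
    ((hW.memLp_increment s t i).aestronglyMeasurable.mul
      (hW.memLp_increment s t j).aestronglyMeasurable)
  simp only [PiLp.sub_apply] at h2
  rw [h2, hW.integral_increment_mul_increment hst, mul_comm]

lemma integrable_mul_increment_mul_increment (hW : IsStandardBrownianMotion P 𝔽 W)
    (s t s' t' : Set.Icc (0 : ℝ) T) (i j : Fin m) {G : Ω → ℝ} (hG : Measurable G)
    {C : ℝ} (hC : ∀ ω, |G ω| ≤ C) :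
    Integrable (fun ω => G ω * ((W t ω i - W s ω i) * (W t' ω j - W s' ω j))) P :=
  ((hW.memLp_increment s t i).integrable_mul (hW.memLp_increment s' t' j)).bdd_mul
    hG.aestronglyMeasurable (.of_forall fun ω => by simpa using hC ω)

/-- Covariance of two weighted increments, the first of which starts earlier. -/
lemma integral_weighted_increments_of_le (hW : IsStandardBrownianMotion P 𝔽 W)
    {l₁ r₁ l₂ r₂ : Set.Icc (0 : ℝ) T} (h₁ : l₁ ≤ r₁) (h₂ : l₂ ≤ r₂) (hl : l₁ ≤ l₂) (i j : Fin m)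
    {G : Ω → ℝ} (hG : Measurable[𝔽 l₂] G) {C : ℝ} (hC : ∀ ω, |G ω| ≤ C) :
    ∫ ω, G ω * ((W r₁ ω i - W l₁ ω i) * (W r₂ ω j - W l₂ ω j)) ∂P =
      (if i = j then max 0 (min (r₁ : ℝ) r₂ - max (l₁ : ℝ) l₂) else 0) * ∫ ω, G ω ∂P := by
  have hG' := hG.mono (𝔽.le l₂) le_rfl
  have key : ∀ {s t r : Set.Icc (0 : ℝ) T}, s ≤ t → t ≤ l₂ → l₂ ≤ r →
      ∫ ω, G ω * ((W t ω i - W s ω i) * (W r ω j - W l₂ ω j)) ∂P = 0 := by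
    intro s t r hs ht hr
    have := hW.integral_mul_increment hr j (G := fun ω => G ω * (W t ω i - W s ω i))
      (hG.mul (((hW.measurable_coord t i).mono (𝔽.mono ht) le_rfl).sub
        ((hW.measurable_coord s i).mono (𝔽.mono (hs.trans ht)) le_rfl)))
    simpa only [mul_assoc] using this
  rcases le_total r₁ l₂ with hr | hr
  · rw [key h₁ hr h₂]
    have : max 0 (min (r₁ : ℝ) r₂ - max (l₁ : ℝ) l₂) = 0 := by
      refine max_eq_left ?_
      have h3 : (r₁ : ℝ) ≤ l₂ := hr
      linarith [min_le_left (r₁ : ℝ) r₂, le_max_right (l₁ : ℝ) l₂]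
    simp [this]
  -- The part of the first increment before `l₂` is known at time `l₂` and contributes zero by
  -- `key`. Then both increments start at `l₂`, and the longer one is cut at the end of the shorter.
  have hsplit : ∫ ω, G ω * ((W r₁ ω i - W l₁ ω i) * (W r₂ ω j - W l₂ ω j)) ∂P =
      ∫ ω, G ω * ((W r₁ ω i - W l₂ ω i) * (W r₂ ω j - W l₂ ω j)) ∂P := by
    rw [← zero_add (∫ ω, G ω * ((W r₁ ω i - W l₂ ω i) * (W r₂ ω j - W l₂ ω j)) ∂P),
      ← key hl le_rfl h₂, ← integral_add
      (hW.integrable_mul_increment_mul_increment _ _ _ _ i j hG' hC)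
      (hW.integrable_mul_increment_mul_increment _ _ _ _ i j hG' hC)]
    congr with ω
    ring
  have hmax : max (l₁ : ℝ) l₂ = l₂ := max_eq_right hl
  rw [hsplit, hmax]
  rcases le_total r₁ r₂ with hrr | hrr
  · have h3 : max 0 (min (r₁ : ℝ) r₂ - l₂) = r₁ - l₂ := by
      rw [min_eq_left (show (r₁ : ℝ) ≤ r₂ from hrr), max_eq_right (sub_nonneg.2 (Subtype.coe_le_coe.2 hr))]
    have h4 := hW.integral_mul_increment hrr j (G := fun ω => G ω * (W r₁ ω i - W l₂ ω i))
      ((hG.mono (𝔽.mono hr) le_rfl).mul ((hW.measurable_coord r₁ i).sub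
        ((hW.measurable_coord l₂ i).mono (𝔽.mono hr) le_rfl)))
    simp only [mul_assoc] at h4
    rw [h3, ← hW.integral_mul_increment_mul_increment hr i j hG, ← add_zero
      (∫ ω, G ω * ((W r₁ ω i - W l₂ ω i) * (W r₁ ω j - W l₂ ω j)) ∂P), ← h4, ← integral_add
      (hW.integrable_mul_increment_mul_increment _ _ _ _ i j hG' hC)
      (hW.integrable_mul_increment_mul_increment _ _ _ _ i j hG' hC)]
    congr with ω
    ring
  · have h3 : max 0 (min (r₁ : ℝ) r₂ - l₂) = r₂ - l₂ := by
      rw [min_eq_right (show (r₂ : ℝ) ≤ r₁ from hrr), max_eq_right (sub_nonneg.2 (Subtype.coe_le_coe.2 h₂))]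
    have h4 := hW.integral_mul_increment hrr i (G := fun ω => G ω * (W r₂ ω j - W l₂ ω j))
      ((hG.mono (𝔽.mono h₂) le_rfl).mul ((hW.measurable_coord r₂ j).sub
        ((hW.measurable_coord l₂ j).mono (𝔽.mono h₂) le_rfl)))
    have h5 : ∫ ω, G ω * ((W r₁ ω i - W r₂ ω i) * (W r₂ ω j - W l₂ ω j)) ∂P = 0 := by
      rw [← h4]
      congr with ω
      ring
    rw [h3, ← hW.integral_mul_increment_mul_increment h₂ i j hG, ← add_zero
      (∫ ω, G ω * ((W r₂ ω i - W l₂ ω i) * (W r₂ ω j - W l₂ ω j)) ∂P), ← h5, ← integral_add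
      (hW.integrable_mul_increment_mul_increment _ _ _ _ i j hG' hC)
      (hW.integrable_mul_increment_mul_increment _ _ _ _ i j hG' hC)]
    congr with ω
    ring

/-- Covariance of two weighted increments whose weights are known at the left end points. -/
lemma integral_weighted_increments (hW : IsStandardBrownianMotion P 𝔽 W)
    {l₁ r₁ l₂ r₂ : Set.Icc (0 : ℝ) T} (h₁ : l₁ ≤ r₁) (h₂ : l₂ ≤ r₂) (i j : Fin m)
    {G H : Ω → ℝ} (hG : Measurable[𝔽 l₁] G) {C : ℝ} (hC : ∀ ω, |G ω| ≤ C)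
    (hH : Measurable[𝔽 l₂] H) {D : ℝ} (hD : ∀ ω, |H ω| ≤ D) :
    ∫ ω, (G ω * (W r₁ ω i - W l₁ ω i)) * (H ω * (W r₂ ω j - W l₂ ω j)) ∂P =
      (if i = j then max 0 (min (r₁ : ℝ) r₂ - max (l₁ : ℝ) l₂) else 0) * ∫ ω, G ω * H ω ∂P := by
  have hCD : ∀ ω, |G ω * H ω| ≤ C * D := fun ω => by
    rw [abs_mul]
    exact mul_le_mul (hC ω) (hD ω) (abs_nonneg _) ((abs_nonneg _).trans (hC ω))
  rcases le_total l₁ l₂ with hl | hl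
  · refine Eq.trans ?_ (hW.integral_weighted_increments_of_le h₁ h₂ hl i j
      ((hG.mono (𝔽.mono hl) le_rfl).mul hH) hCD)
    congr with ω
    ring
  · rw [min_comm, max_comm (l₁ : ℝ)]
    simp only [eq_comm (a := i)]
    refine Eq.trans ?_ (hW.integral_weighted_increments_of_le h₂ h₁ hl j i
      (hG.mul (hH.mono (𝔽.mono hl) le_rfl)) hCD)
    congr with ω
    ring

/-- Covariance of two weighted increments stopped at time `t`. -/
lemma integral_weighted_stopped_increments (hW : IsStandardBrownianMotion P 𝔽 W)
    {l₁ r₁ l₂ r₂ : Set.Icc (0 : ℝ) T} (h₁ : l₁ ≤ r₁) (h₂ : l₂ ≤ r₂) (t : Set.Icc (0 : ℝ) T)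
    (i j : Fin m) {G H : Ω → ℝ} (hG : Measurable[𝔽 l₁] G) {C : ℝ} (hC : ∀ ω, |G ω| ≤ C)
    (hH : Measurable[𝔽 l₂] H) {D : ℝ} (hD : ∀ ω, |H ω| ≤ D) :
    ∫ ω, (G ω * (W (min r₁ t) ω i - W (min l₁ t) ω i)) *
        (H ω * (W (min r₂ t) ω j - W (min l₂ t) ω j)) ∂P =
      (if i = j then max 0 (min (min (r₁ : ℝ) r₂) t - max (l₁ : ℝ) l₂) else 0) *
        ∫ ω, G ω * H ω ∂P := by
  have hz : ∀ {l r : Set.Icc (0 : ℝ) T}, l ≤ r → t ≤ l → min r t = min l t := fun h h' => by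
    rw [min_eq_right h', min_eq_right (h'.trans h)]
  have aux : ∀ x : Set.Icc (0 : ℝ) T, ((min x t : Set.Icc (0 : ℝ) T) : ℝ) = min (x : ℝ) t :=
    fun x => by rcases le_total x t with h | h <;> simp [h]
  rcases le_total t l₁ with ht₁ | ht₁
  · have : max 0 (min (min (r₁ : ℝ) r₂) t - max (l₁ : ℝ) l₂) = 0 := by
      have h3 : (t : ℝ) ≤ l₁ := ht₁
      refine max_eq_left ?_
      linarith [min_le_right (min (r₁ : ℝ) r₂) t, le_max_left (l₁ : ℝ) l₂]
    simp [hz h₁ ht₁, this]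
  rcases le_total t l₂ with ht₂ | ht₂
  · have : max 0 (min (min (r₁ : ℝ) r₂) t - max (l₁ : ℝ) l₂) = 0 := by
      have h3 : (t : ℝ) ≤ l₂ := ht₂
      refine max_eq_left ?_
      linarith [min_le_right (min (r₁ : ℝ) r₂) t, le_max_right (l₁ : ℝ) l₂]
    simp [hz h₂ ht₂, this]
  rw [min_eq_left ht₁, min_eq_left ht₂, hW.integral_weighted_increments (le_min h₁ ht₁)
    (le_min h₂ ht₂) i j hG hC hH hD, aux, aux, ← inf_inf_distrib_right]

end IsStandardBrownianMotion

/-! ### The Itô isometry for simple integrands -/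

lemma timeMeasure_Ioc_inter_Ioc_inter_Iic {T : ℝ} (l₁ r₁ l₂ r₂ t : Set.Icc (0 : ℝ) T) :
    (timeMeasure T).real (Set.Iic t ∩ (Set.Ioc l₁ r₁ ∩ Set.Ioc l₂ r₂)) =
      max 0 (min (min (r₁ : ℝ) r₂) t - max (l₁ : ℝ) l₂) := by
  have h : Subtype.val '' (Set.Iic t ∩ (Set.Ioc l₁ r₁ ∩ Set.Ioc l₂ r₂)) =
      Set.Ioc (max (l₁ : ℝ) l₂) (min (min (r₁ : ℝ) r₂) t) := by
    ext x
    simp only [Set.mem_image, Set.mem_inter_iff, Set.mem_Iic, Set.mem_Ioc, max_lt_iff, le_min_iff]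
    constructor
    · rintro ⟨y, ⟨h1, ⟨h2, h3⟩, h4, h5⟩, rfl⟩
      exact ⟨⟨h2, h4⟩, ⟨h3, h5⟩, h1⟩
    · rintro ⟨⟨h2, h4⟩, ⟨h3, h5⟩, h1⟩
      exact ⟨⟨x, l₁.2.1.trans h2.le, h1.trans t.2.2⟩, ⟨h1, ⟨h2, h3⟩, h4, h5⟩, rfl⟩
  rw [Measure.real, timeMeasure,
    (MeasurableEmbedding.subtype_coe measurableSet_Icc).comap_apply, h, Real.volume_Ioc,
    ENNReal.toReal_ofReal', max_comm]

instance timeMeasure.instIsFiniteMeasure (T : ℝ) : IsFiniteMeasure (timeMeasure T) := by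
  constructor
  rw [timeMeasure, (MeasurableEmbedding.subtype_coe measurableSet_Icc).comap_apply, Set.image_univ,
    Subtype.range_coe]
  exact measure_Icc_lt_top

namespace SimpleIntegrand

variable {Ω : Type*} {mΩ : MeasurableSpace Ω} {T : ℝ} {m : ℕ} {P : Measure Ω}
  {𝔽 : Filtration (Set.Icc (0 : ℝ) T) mΩ} {W : Set.Icc (0 : ℝ) T → Ω → EuclideanSpace ℝ (Fin m)}

lemma measurable_value (S : SimpleIntegrand 𝔽) (ω : Ω) : Measurable fun s => S.value s ω := by
  unfold value
  exact Finset.measurable_fun_sum _ fun i _ => measurable_const.indicator measurableSet_Ioc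

/-- The overlap lengths produced here are the coefficients in
`integral_weighted_stopped_increments`; comparing the two double sums term by term is the isometry.
-/
lemma setIntegral_value_mul_value (S R : SimpleIntegrand 𝔽) (t : Set.Icc (0 : ℝ) T) (ω : Ω) :
    ∫ s in Set.Iic t, S.value s ω * R.value s ω ∂(timeMeasure T) =
      ∑ i, ∑ j, max 0 (min (min (S.right i : ℝ) (R.right j)) t - max (S.left i : ℝ) (R.left j)) *
        (S.Φ i ω * R.Φ j ω) := by
  have h : ∀ s, S.value s ω * R.value s ω = ∑ i, ∑ j,
      (Set.Ioc (S.left i) (S.right i) ∩ Set.Ioc (R.left j) (R.right j)).indicator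
        (fun _ => S.Φ i ω * R.Φ j ω) s := by
    intro s
    simp only [value, Finset.sum_mul_sum]
    refine Finset.sum_congr rfl fun i _ => Finset.sum_congr rfl fun j _ => ?_
    rw [Set.inter_indicator_mul]
  have hm : ∀ i j, MeasurableSet
      (Set.Ioc (S.left i) (S.right i) ∩ Set.Ioc (R.left j) (R.right j)) :=
    fun i j => measurableSet_Ioc.inter measurableSet_Ioc
  have hi : ∀ i j, Integrable ((Set.Ioc (S.left i) (S.right i) ∩
      Set.Ioc (R.left j) (R.right j)).indicator (fun _ => S.Φ i ω * R.Φ j ω))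
      ((timeMeasure T).restrict (Set.Iic t)) :=
    fun i j => (integrable_const _).indicator (hm i j)
  simp_rw [h]
  rw [integral_finsetSum _ fun i _ => integrable_finsetSum _ fun j _ => hi i j]
  refine Finset.sum_congr rfl fun i _ => ?_
  rw [integral_finsetSum _ fun j _ => hi i j]
  refine Finset.sum_congr rfl fun j _ => ?_
  rw [integral_indicator_const _ (hm i j), smul_eq_mul, ← timeMeasure_Ioc_inter_Ioc_inter_Iic,
    Measure.real, Measure.restrict_apply (hm i j), Set.inter_comm, Measure.real]

/-- The **Itô isometry** for simple integrands, in polarized form. -/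
lemma integral_integral_mul_integral (hW : IsStandardBrownianMotion P 𝔽 W) [IsFiniteMeasure P]
    (S R : SimpleIntegrand 𝔽) (i j : Fin m) (t : Set.Icc (0 : ℝ) T) :
    ∫ ω, S.integral (fun s ω => W s ω i) t ω * R.integral (fun s ω => W s ω j) t ω ∂P =
      if i = j then ∫ ω, ∫ s in Set.Iic t, S.value s ω * R.value s ω ∂(timeMeasure T) ∂P
        else 0 := by
  obtain ⟨C, hC⟩ := S.bounded
  obtain ⟨D, hD⟩ := R.bounded
  have hmS := fun k => (S.measurable k).mono (𝔽.le _) le_rfl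
  have hmR := fun k => (R.measurable k).mono (𝔽.le _) le_rfl
  have hb : ∀ k l ω, |S.Φ k ω * R.Φ l ω| ≤ C * D := fun k l ω => by
    rw [abs_mul]
    exact mul_le_mul (hC k ω) (hD l ω) (abs_nonneg _) ((abs_nonneg _).trans (hC k ω))
  have hint : ∀ k l, Integrable (fun ω => S.Φ k ω * R.Φ l ω) P := fun k l =>
    Integrable.of_bound ((hmS k).mul (hmR l)).aestronglyMeasurable (C * D)
      (.of_forall fun ω => hb k l ω)
  have hint2 : ∀ k l, Integrable (fun ω =>
      (S.Φ k ω * (W (min (S.right k) t) ω i - W (min (S.left k) t) ω i)) *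
      (R.Φ l ω * (W (min (R.right l) t) ω j - W (min (R.left l) t) ω j))) P := fun k l => by
    refine (hW.integrable_mul_increment_mul_increment (min (S.left k) t) (min (S.right k) t)
      (min (R.left l) t) (min (R.right l) t) i j ((hmS k).mul (hmR l)) (hb k l)).congr
      (.of_forall fun ω => ?_)
    simp only [Pi.mul_apply]
    ring
  simp_rw [setIntegral_value_mul_value, integral, Finset.sum_mul_sum]
  rw [integral_finsetSum _ fun k _ => integrable_finsetSum _ fun l _ => hint2 k l,
    integral_finsetSum _ fun k _ => integrable_finsetSum _ fun l _ => (hint k l).const_mul _]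
  simp_rw [integral_finsetSum _ fun l _ => hint2 _ l,
    integral_finsetSum _ fun l _ => (hint _ l).const_mul _,
    fun k l => hW.integral_weighted_stopped_increments (S.left_le_right k) (R.left_le_right l) t i j
      (S.measurable k) (hC k) (R.measurable l) (hD l), integral_const_mul]
  split_ifs with hij
  · rfl
  · simp

end SimpleIntegrand

/-! ### Elementary and Itô integrals -/

namespace SimpleIntegrand

variable {Ω : Type*} {mΩ : MeasurableSpace Ω} {T : ℝ} {m : ℕ} {P : Measure Ω}
  {𝔽 : Filtration (Set.Icc (0 : ℝ) T) mΩ} {W : Set.Icc (0 : ℝ) T → Ω → EuclideanSpace ℝ (Fin m)}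

lemma memLp_integral (hW : IsStandardBrownianMotion P 𝔽 W) (S : SimpleIntegrand 𝔽) (i : Fin m)
    (t : Set.Icc (0 : ℝ) T) : MemLp (S.integral (fun s ω => W s ω i) t) 2 P := by
  obtain ⟨C, hC⟩ := S.bounded
  unfold integral
  refine memLp_finsetSum _ fun k _ => ?_
  refine ((hW.memLp_increment (min (S.left k) t) (min (S.right k) t) i).const_mul C).mono
    (((S.measurable k).mono (𝔽.le _) le_rfl).aestronglyMeasurable.mul
      (hW.memLp_increment (min (S.left k) t) (min (S.right k) t) i).aestronglyMeasurable)
    (.of_forall fun ω => ?_)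
  rw [norm_mul, norm_mul]
  gcongr
  exact (hC k ω).trans (le_abs_self C)

lemma integral_integral (hW : IsStandardBrownianMotion P 𝔽 W) [IsFiniteMeasure P]
    (S : SimpleIntegrand 𝔽) (i : Fin m) (t : Set.Icc (0 : ℝ) T) :
    ∫ ω, S.integral (fun s ω => W s ω i) t ω ∂P = 0 := by
  obtain ⟨C, hC⟩ := S.bounded
  unfold integral
  rw [integral_finsetSum _ fun k _ => ?_]
  · refine Finset.sum_eq_zero fun k _ => ?_
    rcases le_total (S.left k) t with h | h
    · rw [min_eq_left h]
      exact hW.integral_mul_increment (le_min (S.left_le_right k) h) i (S.measurable k)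
    · simp [min_eq_right h, min_eq_right (h.trans (S.left_le_right k))]
  · exact ((hW.memLp_increment _ _ i).integrable one_le_two).bdd_mul
      ((S.measurable k).mono (𝔽.le _) le_rfl).aestronglyMeasurable
      (.of_forall fun ω => by simpa using hC k ω)

lemma integrable_value_mul_value (S R : SimpleIntegrand 𝔽) (t : Set.Icc (0 : ℝ) T) (ω : Ω) :
    Integrable (fun s => S.value s ω * R.value s ω) ((timeMeasure T).restrict (Set.Iic t)) := by
  have hb : ∀ S : SimpleIntegrand 𝔽, ∃ C, ∀ s, |S.value s ω| ≤ C := fun S => by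
    obtain ⟨C, hC⟩ := S.bounded
    refine ⟨∑ _i : Fin S.card, C, fun s => (Finset.abs_sum_le_sum_abs _ _).trans
      (Finset.sum_le_sum fun i _ => ?_)⟩
    by_cases h : s ∈ Set.Ioc (S.left i) (S.right i)
    · simpa [h] using hC i ω
    · simpa [h] using (abs_nonneg _).trans (hC i ω)
  obtain ⟨C, hC⟩ := hb S
  obtain ⟨D, hD⟩ := hb R
  refine Integrable.of_bound ((S.measurable_value ω).mul
    (R.measurable_value ω)).aestronglyMeasurable (C * D) (.of_forall fun s => ?_)
  rw [norm_mul]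
  exact mul_le_mul (hC s) (hD s) (norm_nonneg _) ((abs_nonneg _).trans (hC s))

/-- The **Itô isometry** for simple integrands. -/
lemma lintegral_enorm_integral_sq (hW : IsStandardBrownianMotion P 𝔽 W) [IsFiniteMeasure P]
    (S : SimpleIntegrand 𝔽) (i : Fin m) (t : Set.Icc (0 : ℝ) T) :
    ∫⁻ ω, ‖S.integral (fun s ω => W s ω i) t ω‖ₑ ^ 2 ∂P =
      ∫⁻ ω, (∫⁻ s in Set.Iic t, ‖S.value s ω‖ₑ ^ 2 ∂(timeMeasure T)) ∂P := by
  have he : ∀ x : ℝ, ‖x‖ₑ ^ 2 = ENNReal.ofReal (x * x) := fun x => by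
    rw [← ofReal_norm, ← ENNReal.ofReal_pow (norm_nonneg _), Real.norm_eq_abs, sq_abs, sq]
  have h1 := integral_integral_mul_integral hW S S i i t
  rw [if_pos rfl] at h1
  have h2 : ∀ ω, ∫⁻ s in Set.Iic t, ‖S.value s ω‖ₑ ^ 2 ∂(timeMeasure T) =
      ENNReal.ofReal (∫ s in Set.Iic t, S.value s ω * S.value s ω ∂(timeMeasure T)) := fun ω => by
    rw [ofReal_integral_eq_lintegral_ofReal (S.integrable_value_mul_value S t ω)
      (.of_forall fun s => mul_self_nonneg _)]
    simp_rw [he]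
  have h3 : Integrable (fun ω => ∫ s in Set.Iic t, S.value s ω * S.value s ω ∂(timeMeasure T))
      P := by
    simp_rw [setIntegral_value_mul_value]
    obtain ⟨C, hC⟩ := S.bounded
    have hmS := fun k => (S.measurable k).mono (𝔽.le _) le_rfl
    refine integrable_finsetSum _ fun k _ => integrable_finsetSum _ fun l _ =>
      (Integrable.of_bound ((hmS k).mul (hmS l)).aestronglyMeasurable (C * C)
      (.of_forall fun ω => ?_)).const_mul _
    rw [Pi.mul_apply, norm_mul]
    exact mul_le_mul (hC k ω) (hC l ω) (norm_nonneg _) ((abs_nonneg _).trans (hC k ω))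
  simp_rw [h2, he]
  rw [← ofReal_integral_eq_lintegral_ofReal ?_ (.of_forall fun s => mul_self_nonneg _),
    ← ofReal_integral_eq_lintegral_ofReal h3
      (.of_forall fun ω => integral_nonneg fun s => mul_self_nonneg _), h1]
  exact (S.memLp_integral hW i t).integrable_mul (S.memLp_integral hW i t)

/-- The difference of two simple integrands. -/
def sub (S R : SimpleIntegrand 𝔽) : SimpleIntegrand 𝔽 where
  card := S.card + R.card
  left := Fin.addCases S.left R.left
  right := Fin.addCases S.right R.right
  left_le_right := Fin.addCases (fun i => by simpa using S.left_le_right i)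
    (fun i => by simpa using R.left_le_right i)
  Φ := Fin.addCases S.Φ (fun i ω => -R.Φ i ω)
  measurable := Fin.addCases
    (fun i => by rw [Fin.addCases_left, Fin.addCases_left]; exact S.measurable i)
    (fun i => by rw [Fin.addCases_right, Fin.addCases_right]; exact (R.measurable i).neg)
  bounded := by
    obtain ⟨C, hC⟩ := S.bounded
    obtain ⟨D, hD⟩ := R.bounded
    exact ⟨max C D, Fin.addCases (fun i ω => by simpa using Or.inl (hC i ω))
      (fun i ω => by simpa using Or.inr (hD i ω))⟩

lemma sub_value (S R : SimpleIntegrand 𝔽) (s : Set.Icc (0 : ℝ) T) (ω : Ω) :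
    (S.sub R).value s ω = S.value s ω - R.value s ω := by
  simp only [value, sub]
  refine (Fin.sum_univ_add (a := S.card) (b := R.card) _).trans ?_
  rw [sub_eq_add_neg, ← Finset.sum_neg_distrib]
  congr 1
  · simp
  · refine Finset.sum_congr rfl fun i _ => ?_
    simp only [Fin.addCases_right, Set.indicator_apply]
    split_ifs <;> simp

lemma sub_integral (S R : SimpleIntegrand 𝔽) (B : Set.Icc (0 : ℝ) T → Ω → ℝ)
    (t : Set.Icc (0 : ℝ) T) (ω : Ω) :
    (S.sub R).integral B t ω = S.integral B t ω - R.integral B t ω := by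
  simp only [integral, sub]
  refine (Fin.sum_univ_add (a := S.card) (b := R.card) _).trans ?_
  rw [sub_eq_add_neg, ← Finset.sum_neg_distrib]
  simp

end SimpleIntegrand

lemma enorm_sub_sq_le (a b c : ℝ) : ‖a - b‖ₑ ^ 2 ≤ 2 * ‖a - c‖ₑ ^ 2 + 2 * ‖b - c‖ₑ ^ 2 := by
  have h : ∀ x : ℝ, ‖x‖ₑ ^ 2 = ENNReal.ofReal (x ^ 2) := fun x => by
    rw [← ofReal_norm, ← ENNReal.ofReal_pow (norm_nonneg _), Real.norm_eq_abs, sq_abs]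
  rw [h, h, h, ← ENNReal.ofReal_ofNat 2, ← ENNReal.ofReal_mul (by norm_num),
    ← ENNReal.ofReal_mul (by norm_num), ← ENNReal.ofReal_add (by positivity) (by positivity)]
  apply ENNReal.ofReal_le_ofReal
  nlinarith [sq_nonneg (a - c + (b - c))]

/-- The Itô integral of a process which is almost surely equal to a deterministic function `f` is
the limit of the elementary integrals of any simple integrands that converge to `f`. -/
lemma IsItoIntegral.tendsto_lintegral {Ω : Type*} {mΩ : MeasurableSpace Ω} {T : ℝ} {m : ℕ}
    {P : Measure Ω} [IsProbabilityMeasure P] {𝔽 : Filtration (Set.Icc (0 : ℝ) T) mΩ}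
    {W : Set.Icc (0 : ℝ) T → Ω → EuclideanSpace ℝ (Fin m)} (hW : IsStandardBrownianMotion P 𝔽 W)
    {i : Fin m} {H : Set.Icc (0 : ℝ) T → Ω → ℝ} {t : Set.Icc (0 : ℝ) T} {I : Ω → ℝ}
    (hI : IsItoIntegral P 𝔽 (fun s ω => W s ω i) H t I) {f : Set.Icc (0 : ℝ) T → ℝ}
    (hf : Measurable f) (hHf : ∀ᵐ ω ∂P, ∀ s, H s ω = f s) {G : ℕ → SimpleIntegrand 𝔽}
    {g : ℕ → Set.Icc (0 : ℝ) T → ℝ} (hg : ∀ k s ω, (G k).value s ω = g k s)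
    (hlim : Tendsto (fun k => ∫⁻ s in Set.Iic t, ‖g k s - f s‖ₑ ^ 2 ∂(timeMeasure T)) atTop (𝓝 0)) :
    Tendsto (fun k => ∫⁻ ω, ‖(G k).integral (fun s ω => W s ω i) t ω - I ω‖ₑ ^ 2 ∂P)
      atTop (𝓝 0) := by
  obtain ⟨-, hI2, S, hS1, hS2⟩ := hI
  have hS1' : Tendsto (fun k => ∫⁻ ω, (∫⁻ s in Set.Iic t,
      ‖(S k).value s ω - f s‖ₑ ^ 2 ∂(timeMeasure T)) ∂P) atTop (𝓝 0) := by
    refine hS1.congr fun k => lintegral_congr_ae ?_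
    filter_upwards [hHf] with ω hω
    simp_rw [hω]
  -- `g k` is a path of `G k`, so its measurability can be read off at any single sample point.
  have hgm : ∀ k, Measurable (g k) := fun k => by
    obtain ⟨ω⟩ := nonempty_of_isProbabilityMeasure P
    have := (G k).measurable_value ω
    simpa only [hg] using this
  -- Compare `G k` with the sequence `S k` that defines `I`: the isometry turns the difference of
  -- the two elementary integrals into the `L²` distance of the integrands, both of which are close
  -- to `f`.
  have key : ∀ k, ∫⁻ ω, ‖(G k).integral (fun s ω => W s ω i) t ω - I ω‖ₑ ^ 2 ∂P ≤
      2 * (2 * (∫⁻ s in Set.Iic t, ‖g k s - f s‖ₑ ^ 2 ∂(timeMeasure T)) +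
        2 * ∫⁻ ω, (∫⁻ s in Set.Iic t, ‖(S k).value s ω - f s‖ₑ ^ 2 ∂(timeMeasure T)) ∂P) +
      2 * ∫⁻ ω, ‖(S k).integral (fun s ω => W s ω i) t ω - I ω‖ₑ ^ 2 ∂P := by
    intro k
    have hmI : AEMeasurable (fun ω => ‖(S k).integral (fun s ω => W s ω i) t ω - I ω‖ₑ ^ 2) P :=
      (((S k).memLp_integral hW i t).aestronglyMeasurable.sub
        hI2.aestronglyMeasurable).enorm.pow_const 2
    calc ∫⁻ ω, ‖(G k).integral (fun s ω => W s ω i) t ω - I ω‖ₑ ^ 2 ∂P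
        ≤ ∫⁻ ω, (2 * ‖((G k).sub (S k)).integral (fun s ω => W s ω i) t ω‖ₑ ^ 2 +
            2 * ‖(S k).integral (fun s ω => W s ω i) t ω - I ω‖ₑ ^ 2) ∂P := by
          refine lintegral_mono fun ω => ?_
          rw [SimpleIntegrand.sub_integral]
          refine (enorm_sub_sq_le _ (I ω) ((S k).integral (fun s ω => W s ω i) t ω)).trans_eq ?_
          rw [enorm_sub_rev (I ω)]
      _ = 2 * ∫⁻ ω, (∫⁻ s in Set.Iic t, ‖((G k).sub (S k)).value s ω‖ₑ ^ 2 ∂(timeMeasure T)) ∂P +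
            2 * ∫⁻ ω, ‖(S k).integral (fun s ω => W s ω i) t ω - I ω‖ₑ ^ 2 ∂P := by
          rw [lintegral_add_right' _ (hmI.const_mul 2), lintegral_const_mul' _ _ (by simp),
            lintegral_const_mul' _ _ (by simp), SimpleIntegrand.lintegral_enorm_integral_sq hW]
      _ ≤ _ := by
          gcongr
          calc ∫⁻ ω, (∫⁻ s in Set.Iic t, ‖((G k).sub (S k)).value s ω‖ₑ ^ 2 ∂(timeMeasure T)) ∂P
              ≤ ∫⁻ ω, (2 * (∫⁻ s in Set.Iic t, ‖g k s - f s‖ₑ ^ 2 ∂(timeMeasure T)) +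
                2 * ∫⁻ s in Set.Iic t, ‖(S k).value s ω - f s‖ₑ ^ 2 ∂(timeMeasure T)) ∂P := by
                refine lintegral_mono fun ω => ?_
                rw [← lintegral_const_mul' _ _ (by simp), ← lintegral_const_mul' _ _ (by simp),
                  ← lintegral_add_left]
                · refine lintegral_mono fun s => ?_
                  rw [SimpleIntegrand.sub_value, hg]
                  exact enorm_sub_sq_le (g k s) ((S k).value s ω) (f s)
                · exact (((hgm k).sub hf).enorm.pow_const 2).const_mul 2
            _ = _ := by
                rw [lintegral_add_left measurable_const, lintegral_const, measure_univ, mul_one,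
                  lintegral_const_mul' _ _ (by simp)]
  refine tendsto_of_tendsto_of_tendsto_of_le_of_le tendsto_const_nhds ?_ (fun k => zero_le) key
  have h2 : ∀ {u : ℕ → ℝ≥0∞}, Tendsto u atTop (𝓝 0) → Tendsto (fun k => 2 * u k) atTop (𝓝 0) :=
    fun h => by simpa using ENNReal.Tendsto.const_mul h (.inr (by simp : (2 : ℝ≥0∞) ≠ ⊤))
  simpa using (h2 (by simpa using (h2 hlim).add (h2 hS1'))).add (h2 hS2)

/-! ### Gaussianity and the independence of the midpoint bridge -/

/-- Makes finitely many Wiener integrals of step functions jointly Gaussian with the observations of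
`W`. -/
lemma ProbabilityTheory.IsGaussianProcess.of_mem_span {Ω ι κ : Type*} {mΩ : MeasurableSpace Ω}
    {P : Measure Ω} {X : ι → Ω → ℝ} {Y : κ → Ω → ℝ} (hX : IsGaussianProcess X P)
    (hY : ∀ k, Y k ∈ Submodule.span ℝ (Set.range X)) : IsGaussianProcess Y P := by
  refine hX.of_isGaussianProcess fun k => ?_
  obtain ⟨c, hc⟩ := Finsupp.mem_span_range_iff_exists_finsupp.1 (hY k)
  refine ⟨c.support, ∑ i : c.support, c i • ContinuousLinearMap.proj i, fun ω => ?_⟩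
  rw [← hc, Finsupp.sum, Finset.sum_apply, ← Finset.sum_coe_sort]
  simp [Finset.restrict]

namespace IsStandardBrownianMotion

variable {Ω : Type*} {mΩ : MeasurableSpace Ω} {T : ℝ} {m : ℕ} {P : Measure Ω}
  {𝔽 : Filtration (Set.Icc (0 : ℝ) T) mΩ} {W : Set.Icc (0 : ℝ) T → Ω → EuclideanSpace ℝ (Fin m)}

lemma hasIndepIncrements (hW : IsStandardBrownianMotion P 𝔽 W) [IsProbabilityMeasure P] :
    HasIndepIncrements W P := by
  intro n t ht
  refine iIndepFun_iff_measure_inter_preimage_eq_mul.2 fun S => ?_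
  -- Peeling off the latest increment: all earlier ones are measurable at its left end point, where
  -- it is independent of the filtration.
  induction S using Finset.induction_on_max with
  | empty => simp
  | insert a S ha ih =>
    intro A hA
    have haS : a ∉ S := fun h => lt_irrefl a (ha a h)
    rw [Finset.set_biInter_insert, Finset.prod_insert haS,
      ← ih fun i hi => hA i (Finset.mem_insert_of_mem hi), Set.inter_comm, mul_comm]
    have hind := hW.indep (t a.castSucc) (t a.succ) (ht (Fin.castSucc_le_succ a))
    refine Indep_iff _ _ _ |>.1 hind.symm _ _ ?_ ⟨A a, hA a (Finset.mem_insert_self _ _), rfl⟩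
    refine Finset.measurableSet_biInter S fun i hi => ?_
    have hle : t i.succ ≤ t a.castSucc := ht (Fin.succ_le_castSucc_iff.2 (ha i hi))
    have hle' : t i.castSucc ≤ t i.succ := ht (Fin.castSucc_le_succ i)
    exact (((hW.adapted _).mono (𝔽.mono hle) le_rfl).sub
      ((hW.adapted _).mono (𝔽.mono (hle'.trans hle)) le_rfl)) (hA i (Finset.mem_insert_of_mem hi))

lemma hasGaussianLaw_increment (hW : IsStandardBrownianMotion P 𝔽 W) {s t : Set.Icc (0 : ℝ) T}
    (hst : s ≤ t) : HasGaussianLaw (fun ω => W t ω - W s ω) P := by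
  have h1 : HasGaussianLaw (fun x (i : Fin m) => x i)
      (Measure.pi fun _ : Fin m => gaussianReal 0 (Real.toNNReal ((t : ℝ) - s))) :=
    iIndepFun.hasGaussianLaw (X := fun i (x : Fin m → ℝ) => x i)
      (fun i => (measurePreserving_eval
        (fun _ : Fin m => gaussianReal 0 (Real.toNNReal ((t : ℝ) - s))) i).hasLaw.hasGaussianLaw)
      (iIndepFun_pi (X := fun _ x => x) fun _ => aemeasurable_id)
  have h2 : IsGaussian (Measure.pi fun _ : Fin m =>
      gaussianReal 0 (Real.toNNReal ((t : ℝ) - s))) := by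
    simpa using! h1.isGaussian_map
  have h3 := (hW.law s t hst).hasGaussianLaw
  exact h3.map_fun (PiLp.continuousLinearEquiv 2 ℝ fun _ : Fin m => ℝ).symm.toContinuousLinearMap

lemma isGaussianProcess (hW : IsStandardBrownianMotion P 𝔽 W) [IsProbabilityMeasure P]
    (hT : 0 ≤ T) : IsGaussianProcess (fun (q : Set.Icc (0 : ℝ) T × Fin m) ω => W q.1 ω q.2) P := by
  -- A bottom element is the starting time: `W` vanishes there almost surely, so each `W t` has the
  -- law of an increment.
  let _ : OrderBot (Set.Icc (0 : ℝ) T) := { bot := ⟨0, le_rfl, hT⟩, bot_le := fun s => s.2.1 }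
  have h0 : ∀ᵐ ω ∂P, W ⊥ ω = 0 := hW.start _ rfl
  have h1 : IsGaussianProcess W P := by
    refine HasIndepIncrements.isGaussianProcess (fun t => ?_) h0 hW.hasIndepIncrements
    refine (hW.hasGaussianLaw_increment (bot_le : ⊥ ≤ t)).congr ?_
    filter_upwards [h0] with ω hω
    simp [hω]
  exact (h1.comp_right Prod.fst).comp_left
    (fun q : Set.Icc (0 : ℝ) T × Fin m => EuclideanSpace.proj q.2)

end IsStandardBrownianMotion

namespace SimpleIntegrand

variable {Ω : Type*} {mΩ : MeasurableSpace Ω} {T : ℝ} {m : ℕ} {P : Measure Ω}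
  {W : Set.Icc (0 : ℝ) T → Ω → EuclideanSpace ℝ (Fin m)}

/-- The simple integrand with constant coefficients `c i` on the intervals `(l i, r i]`. -/
def ofConst (𝔽 : Filtration (Set.Icc (0 : ℝ) T) mΩ) {n : ℕ} (l r : Fin n → Set.Icc (0 : ℝ) T)
    (h : ∀ i, l i ≤ r i) (c : Fin n → ℝ) : SimpleIntegrand 𝔽 where
  card := n
  left := l
  right := r
  left_le_right := h
  Φ i _ := c i
  measurable _ := measurable_const
  bounded := ⟨∑ i, |c i|, fun i _ =>
    Finset.single_le_sum (f := fun i => |c i|) (fun _ _ => abs_nonneg _) (Finset.mem_univ i)⟩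

/-- The step function underlying `SimpleIntegrand.ofConst`. -/
noncomputable def constValue {n : ℕ} (l r : Fin n → Set.Icc (0 : ℝ) T) (c : Fin n → ℝ)
    (s : Set.Icc (0 : ℝ) T) : ℝ :=
  ∑ i, (Set.Ioc (l i) (r i)).indicator (fun _ => c i) s

variable {𝔽 : Filtration (Set.Icc (0 : ℝ) T) mΩ} {n : ℕ} {l r : Fin n → Set.Icc (0 : ℝ) T}
  {h : ∀ i, l i ≤ r i} {c : Fin n → ℝ}
  {n' : ℕ} {l' r' : Fin n' → Set.Icc (0 : ℝ) T} {h' : ∀ i, l' i ≤ r' i} {c' : Fin n' → ℝ}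

lemma ofConst_value (s : Set.Icc (0 : ℝ) T) (ω : Ω) :
    (ofConst 𝔽 l r h c).value s ω = constValue l r c s := rfl

lemma ofConst_integral (B : Set.Icc (0 : ℝ) T → Ω → ℝ) (t : Set.Icc (0 : ℝ) T) (ω : Ω) :
    (ofConst 𝔽 l r h c).integral B t ω =
      ∑ k, c k * (B (min (r k) t) ω - B (min (l k) t) ω) := rfl

lemma setIntegral_constValue_mul_constValue (h : ∀ i, l i ≤ r i) (h' : ∀ i, l' i ≤ r' i)
    (t : Set.Icc (0 : ℝ) T) :
    ∫ s in Set.Iic t, constValue l r c s * constValue l' r' c' s ∂(timeMeasure T) =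
      ∑ i, ∑ j, max 0 (min (min (r i : ℝ) (r' j)) t - max (l i : ℝ) (l' j)) * (c i * c' j) :=
  -- The deterministic identity is the random one over a one-point sample space.
  setIntegral_value_mul_value (ofConst (⊥ : Filtration _ (⊤ : MeasurableSpace Unit)) l r h c)
    (ofConst ⊥ l' r' h' c') t ()

lemma ofConst_integral_mem_span (i : Fin m) (t : Set.Icc (0 : ℝ) T) :
    (ofConst 𝔽 l r h c).integral (fun s ω => W s ω i) t ∈
      Submodule.span ℝ (Set.range fun (q : Set.Icc (0 : ℝ) T × Fin m) ω => W q.1 ω q.2) := by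
  have : (ofConst 𝔽 l r h c).integral (fun s ω => W s ω i) t = ∑ k, c k •
      ((fun ω => W (min (r k) t) ω i) - fun ω => W (min (l k) t) ω i) := by
    ext ω
    simp [ofConst_integral]
  rw [this]
  exact Submodule.sum_mem _ fun k _ => Submodule.smul_mem _ _ (Submodule.sub_mem _
    (Submodule.subset_span ⟨(min (r k) t, i), rfl⟩) (Submodule.subset_span ⟨(min (l k) t, i), rfl⟩))

/-- Reduces independence of Wiener integrals to orthogonality of step functions. -/
lemma covariance_ofConst_integral (hW : IsStandardBrownianMotion P 𝔽 W) [IsProbabilityMeasure P]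
    (i j : Fin m) (t : Set.Icc (0 : ℝ) T) :
    cov[(ofConst 𝔽 l r h c).integral (fun s ω => W s ω i) t,
        (ofConst 𝔽 l' r' h' c').integral (fun s ω => W s ω j) t; P] =
      if i = j then ∫ s in Set.Iic t, constValue l r c s * constValue l' r' c' s ∂(timeMeasure T)
      else 0 := by
  rw [covariance_eq_sub (memLp_integral hW _ _ _) (memLp_integral hW _ _ _),
    integral_integral hW, zero_mul, sub_zero]
  refine (integral_integral_mul_integral hW _ _ i j t).trans ?_
  simp [ofConst_value]

end SimpleIntegrand

section Bridge

variable {Ω : Type*} {mΩ : MeasurableSpace Ω} {T : ℝ} {m : ℕ} {P : Measure Ω}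
  {W : Set.Icc (0 : ℝ) T → Ω → EuclideanSpace ℝ (Fin m)}

/-- The integrand `½ 1_{(a,p]} - ½ 1_{(p,b]}`. -/
noncomputable def bridgeIntegrand (𝔽 : Filtration (Set.Icc (0 : ℝ) T) mΩ)
    {a p b : Set.Icc (0 : ℝ) T} (hap : a ≤ p) (hpb : p ≤ b) : SimpleIntegrand 𝔽 :=
  .ofConst 𝔽 ![a, p] ![p, b] (fun i => by fin_cases i <;> simpa) ![1 / 2, -(1 / 2)]

/-- The step function `½ 1_{(a,p]} - ½ 1_{(p,b]}`. -/
noncomputable def bridgeValue (a p b : Set.Icc (0 : ℝ) T) : Set.Icc (0 : ℝ) T → ℝ :=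
  SimpleIntegrand.constValue ![a, p] ![p, b] ![1 / 2, -(1 / 2)]

variable {𝔽 : Filtration (Set.Icc (0 : ℝ) T) mΩ} {a p b : Set.Icc (0 : ℝ) T}

lemma covariance_bridge_eval (hW : IsStandardBrownianMotion P 𝔽 W) [IsProbabilityMeasure P]
    (hT : 0 ≤ T) (hap : a ≤ p) (hpb : p ≤ b) (hmid : (p : ℝ) - a = b - p) (i j : Fin m)
    {s t : Set.Icc (0 : ℝ) T} (ht : ∀ s, s ≤ t) (hs : s ≤ a ∨ b ≤ s) :
    cov[fun ω => W s ω j, (bridgeIntegrand 𝔽 hap hpb).integral (fun s ω => W s ω i) t; P] = 0 := by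
  set o : Set.Icc (0 : ℝ) T := ⟨0, le_rfl, hT⟩
  have ho : ∀ s, o ≤ s := fun s => s.2.1
  have h0 : ∀ᵐ ω ∂P, W o ω = 0 := hW.start _ rfl
  -- `W s` is almost surely the Wiener integral of `1_{(0,s]}`, so its covariance with the bridge is
  -- an inner product of step functions.
  set R : SimpleIntegrand 𝔽 := .ofConst 𝔽 ![o] ![s] (fun i => by fin_cases i; simpa using ho s) ![1]
    with hR
  have h1 : (fun ω => W s ω j) =ᵐ[P] R.integral (fun s ω => W s ω j) t := by
    filter_upwards [h0] with ω hω
    simp [hR, SimpleIntegrand.ofConst_integral, ht s, ht o, hω]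
  have h2 : cov[fun ω => W s ω j,
      (bridgeIntegrand 𝔽 hap hpb).integral (fun s ω => W s ω i) t; P] =
      cov[R.integral (fun s ω => W s ω j) t,
        (bridgeIntegrand 𝔽 hap hpb).integral (fun s ω => W s ω i) t; P] := by
    unfold covariance
    rw [integral_congr_ae h1]
    refine integral_congr_ae ?_
    filter_upwards [h1] with ω hω
    rw [hω]
  rw [h2, bridgeIntegrand, hR, SimpleIntegrand.covariance_ofConst_integral hW]
  split_ifs with hij
  · rw [SimpleIntegrand.setIntegral_constValue_mul_constValue
      (fun i => by fin_cases i; simpa using ho s) (fun i => by fin_cases i <;> simpa)]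
    have e0 : (o : ℝ) = 0 := rfl
    have ha0 := a.2.1
    have hst : (s : ℝ) ≤ t := ht s
    have hbt : (b : ℝ) ≤ t := ht b
    have hpt : (p : ℝ) ≤ t := ht p
    have hap' : (a : ℝ) ≤ p := hap
    have hpb' : (p : ℝ) ≤ b := hpb
    simp only [Fin.sum_univ_two, Matrix.cons_val_zero,
      Matrix.cons_val_one, Finset.univ_unique, Fin.default_eq_zero, Finset.sum_singleton, e0,
      Matrix.cons_val_fin_one]
    rw [max_eq_right ha0, max_eq_right (ha0.trans hap')]
    -- For `s ≤ a` neither half of the bridge meets `(0, s]`. For `b ≤ s` both lie inside it and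
    -- cancel, because `p` is the midpoint.
    rcases hs with hs | hs
    · have hs' : (s : ℝ) ≤ a := hs
      rw [min_eq_left (hs'.trans hap'), min_eq_left ((hs'.trans hap').trans hpb'), min_eq_left hst,
        max_eq_left (by linarith), max_eq_left (by linarith)]
      ring
    · have hs' : (b : ℝ) ≤ s := hs
      rw [min_eq_right (hpb'.trans hs'), min_eq_right hs', min_eq_left hpt, min_eq_left hbt,
        max_eq_right (by linarith), max_eq_right (by linarith), hmid]
      ring
  · rfl

/-- The midpoint bridge `B` is independent of the observations of `W` outside of `(a, b)` together
with any elementary integral from which the projection onto `B` was removed. -/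
lemma indepFun_bridge (hW : IsStandardBrownianMotion P 𝔽 W) [IsProbabilityMeasure P]
    (hT : 0 ≤ T) (hap : a ≤ p) (hpb : p ≤ b) (hmid : (p : ℝ) - a = b - p) (i : Fin m)
    {t : Set.Icc (0 : ℝ) T} (ht : ∀ s, s ≤ t) {K : Set (Set.Icc (0 : ℝ) T)}
    (hK : ∀ s ∈ K, s ≤ a ∨ b ≤ s)
    {n : ℕ} {l r : Fin n → Set.Icc (0 : ℝ) T} {h : ∀ i, l i ≤ r i} {c : Fin n → ℝ} {κ : ℝ}
    (hκ : ∫ s in Set.Iic t, SimpleIntegrand.constValue l r c s * bridgeValue a p b s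
        ∂(timeMeasure T) =
      κ * ∫ s in Set.Iic t, bridgeValue a p b s * bridgeValue a p b s ∂(timeMeasure T))
    {U : Ω → ℝ} (hU : Measurable[MeasurableSpace.comap
      (fun ω (q : K × Fin m) => W q.1 ω q.2) MeasurableSpace.pi] U) :
    IndepFun (fun ω => (U ω, (SimpleIntegrand.ofConst 𝔽 l r h c).integral (fun s ω => W s ω i) t ω -
        κ * (bridgeIntegrand 𝔽 hap hpb).integral (fun s ω => W s ω i) t ω))
      ((bridgeIntegrand 𝔽 hap hpb).integral (fun s ω => W s ω i) t) P := by
  set S := SimpleIntegrand.ofConst 𝔽 l r h c with hS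
  set B := (bridgeIntegrand 𝔽 hap hpb).integral (fun s ω => W s ω i) t with hB
  set M := fun ω => S.integral (fun s ω => W s ω i) t ω - κ * B ω with hM
  -- The index `none` carries `M`, the others the observations. Zero covariance is checked for this
  -- Gaussian family only; `U`, which need not be Gaussian, enters through the σ-algebra.
  let X : Option (K × Fin m) → Ω → ℝ := fun q => q.elim M fun q ω => W q.1 ω q.2
  let Y : Unit → Ω → ℝ := fun _ => B
  have hBspan : B ∈ Submodule.span ℝ
      (Set.range fun (q : Set.Icc (0 : ℝ) T × Fin m) ω => W q.1 ω q.2) :=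
    SimpleIntegrand.ofConst_integral_mem_span i t
  have hMspan : M ∈ Submodule.span ℝ
      (Set.range fun (q : Set.Icc (0 : ℝ) T × Fin m) ω => W q.1 ω q.2) :=
    Submodule.sub_mem _ (SimpleIntegrand.ofConst_integral_mem_span i t)
      (Submodule.smul_mem _ κ hBspan)
  have hXY : IsGaussianProcess (Sum.elim X Y) P := by
    refine (hW.isGaussianProcess hT).of_mem_span ?_
    rintro ((_ | q) | _)
    · exact hMspan
    · exact Submodule.subset_span ⟨(q.1, q.2), rfl⟩
    · exact hBspan
  have hBL : MemLp B 2 P := SimpleIntegrand.memLp_integral hW _ i t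
  have hSL : MemLp (S.integral (fun s ω => W s ω i) t) 2 P :=
    SimpleIntegrand.memLp_integral hW _ i t
  have hind : IndepFun (fun ω s => X s ω) (fun ω s => Y s ω) P := by
    refine hXY.indepFun_of_covariance_eq_zero (fun q => hXY.aemeasurable (.inl q))
      (fun q => hXY.aemeasurable (.inr q)) ?_
    rintro (_ | q) _
    · change cov[M, B; P] = 0
      have h3 : cov[B, B; P] = ∫ s in Set.Iic t, bridgeValue a p b s * bridgeValue a p b s
          ∂(timeMeasure T) :=
        (SimpleIntegrand.covariance_ofConst_integral hW i i t).trans (if_pos rfl)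
      have h4 : cov[S.integral (fun s ω => W s ω i) t, B; P] =
          ∫ s in Set.Iic t, SimpleIntegrand.constValue l r c s * bridgeValue a p b s
          ∂(timeMeasure T) :=
        (SimpleIntegrand.covariance_ofConst_integral hW i i t).trans (if_pos rfl)
      rw [hM, covariance_fun_sub_left hSL (hBL.const_mul κ) hBL, covariance_const_mul_left, h3, h4,
        hκ, sub_self]
    · exact covariance_bridge_eval hW hT hap hpb hmid i q.2 ht (hK _ q.1.2)
  rw [IndepFun_iff_Indep] at hind ⊢
  refine indep_of_indep_of_le_left (indep_of_indep_of_le_right hind ?_) ?_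
  · exact Measurable.comap_le ((measurable_pi_apply ()).comp (comap_measurable fun ω s => Y s ω))
  · refine Measurable.comap_le (Measurable.prodMk
      (m := MeasurableSpace.comap (fun ω s => X s ω) MeasurableSpace.pi) ?_ ?_)
    · refine hU.mono ?_ le_rfl
      rw [show (fun ω (q : K × Fin m) => W q.1 ω q.2) =
        (fun (x : Option (K × Fin m) → ℝ) q => x (some q)) ∘ (fun ω s => X s ω) from rfl,
        ← MeasurableSpace.comap_comp]
      exact MeasurableSpace.comap_mono
        (measurable_pi_lambda _ fun q => measurable_pi_apply (some q)).comap_le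
    · exact (measurable_pi_apply none).comp (comap_measurable (fun ω s => X s ω))

end Bridge

/-! ### Step function approximation of deterministic integrands -/

section StepFunction

/-- The point `τ i / (k + 1)` of the equidistant grid of `[0, τ]`. -/
noncomputable def gridPoint {T : ℝ} (hT : 0 ≤ T) (τ : ℝ) (k i : ℕ) : Set.Icc (0 : ℝ) T :=
  Set.projIcc 0 T hT (τ * i / (k + 1))

lemma gridPoint_le_gridPoint_succ {T : ℝ} (hT : 0 ≤ T) {τ : ℝ} (hτ : 0 ≤ τ) (k i : ℕ) :
    gridPoint hT τ k i ≤ gridPoint hT τ k (i + 1) := by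
  refine Set.monotone_projIcc hT ?_
  gcongr
  simp

/-- The piecewise constant function with value `f (τ i / (k + 1))` on the `i`-th interval of the
equidistant grid of `[0, τ]`. -/
noncomputable def stepValue {T : ℝ} (hT : 0 ≤ T) (f : ℝ → ℝ) (τ : ℝ) (k : ℕ) :
    Set.Icc (0 : ℝ) T → ℝ :=
  SimpleIntegrand.constValue (fun i : Fin (k + 1) => gridPoint hT τ k i)
    (fun i : Fin (k + 1) => gridPoint hT τ k (i + 1)) (fun i => f (τ * i / (k + 1)))

/-- The simple integrand with value `stepValue`. -/
noncomputable def stepIntegrand {Ω : Type*} {mΩ : MeasurableSpace Ω} {T : ℝ}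
    (𝔽 : Filtration (Set.Icc (0 : ℝ) T) mΩ) (hT : 0 ≤ T) (f : ℝ → ℝ) {τ : ℝ} (hτ : 0 ≤ τ) (k : ℕ) :
    SimpleIntegrand 𝔽 :=
  .ofConst 𝔽 (fun i : Fin (k + 1) => gridPoint hT τ k i)
    (fun i : Fin (k + 1) => gridPoint hT τ k (i + 1))
    (fun i => gridPoint_le_gridPoint_succ hT hτ k i) (fun i => f (τ * i / (k + 1)))

variable {T τ : ℝ} (hT : 0 ≤ T) {f : ℝ → ℝ}

lemma coe_gridPoint (hτ : 0 ≤ τ) (hτT : τ ≤ T) {k i : ℕ} (hi : i ≤ k + 1) :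
    (gridPoint hT τ k i : ℝ) = τ * i / (k + 1) := by
  have hk : (0 : ℝ) < k + 1 := by positivity
  have hi' : (i : ℝ) ≤ k + 1 := by exact_mod_cast hi
  have h1 : τ * i / (k + 1) ≤ T := by
    rw [div_le_iff₀ hk]
    calc τ * i ≤ τ * (k + 1) := by gcongr
      _ ≤ T * (k + 1) := by gcongr
  rw [gridPoint, Set.projIcc_of_mem hT ⟨by positivity, h1⟩]

lemma measurable_constValue {n : ℕ} (l r : Fin n → Set.Icc (0 : ℝ) T) (c : Fin n → ℝ) :
    Measurable (SimpleIntegrand.constValue l r c) :=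
  Finset.measurable_fun_sum _ fun _ _ => measurable_const.indicator measurableSet_Ioc

/-- The point `s` lies in the cell `(τ j / (k+1), τ (j+1) / (k+1)]` with `j + 1 = ⌈s (k+1) / τ⌉`.
Time zero is excluded because the cells are open on the left. -/
lemma stepValue_eq_of_le (hτ : 0 < τ) (hτT : τ ≤ T) (k : ℕ) {s : Set.Icc (0 : ℝ) T}
    (hs : 0 < (s : ℝ)) (hsτ : (s : ℝ) ≤ τ) :
    ∃ x : ℝ, |x - (s : ℝ)| ≤ τ / (k + 1) ∧ stepValue hT f τ k s = f x := by
  have hk : (0 : ℝ) < k + 1 := by positivity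
  obtain ⟨j, hj⟩ : ∃ j, ⌈(s : ℝ) * (k + 1) / τ⌉₊ = j + 1 :=
    Nat.exists_eq_succ_of_ne_zero (Nat.ceil_pos.2 (by positivity)).ne'
  have hj1 : (j : ℝ) < s * (k + 1) / τ := Nat.lt_ceil.1 (by omega)
  have hj2 : (s : ℝ) * (k + 1) / τ ≤ (j + 1 : ℕ) := Nat.ceil_le.1 hj.le
  have hjk : j < k + 1 := by
    have : (s : ℝ) * (k + 1) / τ ≤ k + 1 := by
      rw [div_le_iff₀ hτ, mul_comm]
      gcongr
    exact_mod_cast hj1.trans_le this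
  have hj1' : τ * j / (k + 1) < s := by
    rw [lt_div_iff₀ hτ] at hj1
    rw [div_lt_iff₀ hk]
    linarith
  have hj2' : (s : ℝ) ≤ τ * (j + 1 : ℕ) / (k + 1) := by
    rw [div_le_iff₀ hτ] at hj2
    rw [le_div_iff₀ hk]
    linarith
  refine ⟨τ * j / (k + 1), ?_, ?_⟩
  · rw [abs_sub_comm, abs_of_nonneg (by linarith)]
    have : τ * (j + 1 : ℕ) / (k + 1) = τ * j / (k + 1) + τ / (k + 1) := by
      push_cast; ring
    linarith
  · rw [stepValue, SimpleIntegrand.constValue, Finset.sum_eq_single (⟨j, hjk⟩ : Fin (k + 1))]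
    · rw [Set.indicator_of_mem]
      refine ⟨?_, ?_⟩
      · rw [← Subtype.coe_lt_coe, coe_gridPoint hT hτ.le hτT (by simpa using hjk.le)]
        exact hj1'
      · rw [← Subtype.coe_le_coe, coe_gridPoint hT hτ.le hτT (by simpa using hjk)]
        exact hj2'
    · intro i _ hij
      rw [Set.indicator_of_notMem]
      rintro ⟨h1, h2⟩
      rw [← Subtype.coe_lt_coe, coe_gridPoint hT hτ.le hτT i.2.le] at h1
      rw [← Subtype.coe_le_coe, coe_gridPoint hT hτ.le hτT i.2] at h2
      have h3 : (i : ℕ) < j + 1 := by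
        have := h1.trans_le hj2'
        rw [div_lt_div_iff_of_pos_right hk] at this
        exact_mod_cast lt_of_mul_lt_mul_left this hτ.le
      have h4 : j < (i : ℕ) + 1 := by
        have := hj1'.trans_le h2
        rw [div_lt_div_iff_of_pos_right hk] at this
        exact_mod_cast lt_of_mul_lt_mul_left this hτ.le
      exact hij (Fin.ext (by simp; omega))
    · simp

lemma stepValue_eq_zero (hτ : 0 < τ) (hτT : τ ≤ T) (k : ℕ) {s : Set.Icc (0 : ℝ) T}
    (hs : τ < (s : ℝ)) : stepValue hT f τ k s = 0 := by
  have hk : (0 : ℝ) < k + 1 := by positivity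
  rw [stepValue, SimpleIntegrand.constValue]
  refine Finset.sum_eq_zero fun i _ => ?_
  rw [Set.indicator_of_notMem]
  rintro ⟨-, h2⟩
  rw [← Subtype.coe_le_coe, coe_gridPoint hT hτ.le hτT i.2] at h2
  have hi : (((i : ℕ) + 1 : ℕ) : ℝ) ≤ k + 1 := by exact_mod_cast i.2
  have : τ * ((i : ℕ) + 1 : ℕ) / (k + 1) ≤ τ := by
    rw [div_le_iff₀ hk]
    gcongr
  linarith

lemma abs_stepValue_le (hτ : 0 < τ) (hτT : τ ≤ T) {C : ℝ} (hC : ∀ x, |f x| ≤ C) (k : ℕ)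
    (s : Set.Icc (0 : ℝ) T) (hs : 0 < (s : ℝ)) : |stepValue hT f τ k s| ≤ C := by
  rcases lt_or_ge τ s with h | h
  · rw [stepValue_eq_zero hT hτ hτT k h, abs_zero]
    exact (abs_nonneg _).trans (hC 0)
  · obtain ⟨x, -, hx⟩ := stepValue_eq_of_le (f := f) hT hτ hτT k hs h
    exact hx ▸ hC x

lemma tendsto_stepValue (hτ : 0 < τ) (hτT : τ ≤ T) (hf : Continuous f) (hf0 : ∀ x, τ < x → f x = 0)
    {s : Set.Icc (0 : ℝ) T} (hs : 0 < (s : ℝ)) :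
    Tendsto (fun k => stepValue hT f τ k s) atTop (𝓝 (f s)) := by
  rcases lt_or_ge τ s with h | h
  · simp [stepValue_eq_zero hT hτ hτT _ h, hf0 _ h]
  · choose x hx1 hx2 using fun k => stepValue_eq_of_le (f := f) hT hτ hτT k hs h
    simp_rw [hx2]
    refine (hf.tendsto _).comp (tendsto_iff_dist_tendsto_zero.2 ?_)
    refine squeeze_zero (fun _ => dist_nonneg) hx1 ?_
    simpa [div_eq_mul_inv] using (tendsto_one_div_add_atTop_nhds_zero_nat (𝕜 := ℝ)).const_mul τ

lemma ae_timeMeasure_pos : ∀ᵐ s : Set.Icc (0 : ℝ) T ∂(timeMeasure T), 0 < (s : ℝ) := by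
  have : {s : Set.Icc (0 : ℝ) T | ¬ 0 < (s : ℝ)} ⊆ Subtype.val ⁻¹' {0} := fun s hs =>
    le_antisymm (not_lt.1 hs) s.2.1
  refine measure_mono_null this ?_
  rw [timeMeasure, (MeasurableEmbedding.subtype_coe measurableSet_Icc).comap_apply]
  exact measure_mono_null (Set.image_preimage_subset _ _) (by simp)

lemma tendsto_lintegral_stepValue (hτ : 0 < τ) (hτT : τ ≤ T) (hf : Continuous f) {C : ℝ}
    (hC : ∀ x, |f x| ≤ C) (hf0 : ∀ x, τ < x → f x = 0) (t : Set.Icc (0 : ℝ) T) :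
    Tendsto (fun k => ∫⁻ s in Set.Iic t, ‖stepValue hT f τ k s - f s‖ₑ ^ 2 ∂(timeMeasure T))
      atTop (𝓝 0) := by
  have h0 : (0 : ℝ≥0∞) = ∫⁻ _ in Set.Iic t, 0 ∂(timeMeasure T) := by simp
  rw [h0]
  refine tendsto_lintegral_of_dominated_convergence (fun _ => ENNReal.ofReal (2 * C) ^ 2)
    (fun k => (((measurable_constValue _ _ _).sub
      (hf.measurable.comp measurable_subtype_coe)).enorm.pow_const 2)) (fun k => ?_) ?_ ?_
  · filter_upwards [ae_restrict_of_ae ae_timeMeasure_pos] with s hs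
    gcongr
    rw [Real.enorm_eq_ofReal_abs]
    apply ENNReal.ofReal_le_ofReal
    linarith [abs_sub (stepValue hT f τ k s) (f s), abs_stepValue_le hT hτ hτT hC k s hs, hC s]
  · simp only [lintegral_const]
    exact ENNReal.mul_ne_top (ENNReal.pow_ne_top ENNReal.ofReal_ne_top) (measure_ne_top _ _)
  · filter_upwards [ae_restrict_of_ae ae_timeMeasure_pos] with s hs
    have h1 := ((tendsto_stepValue hT hτ hτT hf hf0 hs).sub_const (f s)).enorm
    simpa using ENNReal.Tendsto.pow (n := 2) h1

lemma tendsto_setIntegral_stepValue_mul (hτ : 0 < τ) (hτT : τ ≤ T) (hf : Continuous f) {C : ℝ}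
    (hC : ∀ x, |f x| ≤ C) (hf0 : ∀ x, τ < x → f x = 0) (t : Set.Icc (0 : ℝ) T)
    {g : ℕ → Set.Icc (0 : ℝ) T → ℝ} {g' : Set.Icc (0 : ℝ) T → ℝ} (hg : ∀ k, Measurable (g k))
    {D : ℝ} (hD : ∀ k (s : Set.Icc (0 : ℝ) T), 0 < (s : ℝ) → |g k s| ≤ D)
    (hlim : ∀ s : Set.Icc (0 : ℝ) T, 0 < (s : ℝ) → Tendsto (fun k => g k s) atTop (𝓝 (g' s))) :
    Tendsto (fun k => ∫ s in Set.Iic t, stepValue hT f τ k s * g k s ∂(timeMeasure T))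
      atTop (𝓝 (∫ s in Set.Iic t, f s * g' s ∂(timeMeasure T))) := by
  refine tendsto_integral_of_dominated_convergence (fun _ => C * D)
    (fun k => ((measurable_constValue _ _ _).mul (hg k)).aestronglyMeasurable)
    (integrable_const _) (fun k => ?_) ?_
  · filter_upwards [ae_restrict_of_ae ae_timeMeasure_pos] with s hs
    rw [norm_mul]
    exact mul_le_mul (abs_stepValue_le hT hτ hτT hC k s hs) (hD k s hs) (norm_nonneg _)
      ((abs_nonneg _).trans (hC 0))
  · filter_upwards [ae_restrict_of_ae ae_timeMeasure_pos] with s hs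
    exact (tendsto_stepValue hT hτ hτT hf hf0 hs).mul (hlim s hs)

/-- The right side does not involve `t`: this is why the second coordinate is frozen after `τ`. -/
lemma stepIntegrand_integral_eq {Ω : Type*} {mΩ : MeasurableSpace Ω}
    {𝔽 : Filtration (Set.Icc (0 : ℝ) T) mΩ} (hτ : 0 ≤ τ) (hτT : τ ≤ T) (k : ℕ)
    (B : Set.Icc (0 : ℝ) T → Ω → ℝ) {t : Set.Icc (0 : ℝ) T} (ht : τ ≤ t) (ω : Ω) :
    (stepIntegrand 𝔽 hT f hτ k).integral B t ω =
      ∑ i : Fin (k + 1), f (τ * i / (k + 1)) *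
        (B (gridPoint hT τ k (i + 1)) ω - B (gridPoint hT τ k i) ω) := by
  have h : ∀ i, i ≤ k + 1 → gridPoint hT τ k i ≤ t := fun i hi => by
    rw [← Subtype.coe_le_coe, coe_gridPoint hT hτ hτT hi, div_le_iff₀ (by positivity)]
    have : (i : ℝ) ≤ k + 1 := by exact_mod_cast hi
    exact mul_le_mul ht this (by positivity) (hτ.trans ht)
  rw [stepIntegrand, SimpleIntegrand.ofConst_integral]
  refine Finset.sum_congr rfl fun i _ => ?_
  rw [min_eq_left (h _ i.2), min_eq_left (h _ i.2.le)]

end StepFunction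

/-! ### A scalar ordinary differential equation -/

lemma setIntegral_timeMeasure {T : ℝ} (hT : 0 ≤ T) (q : Set.Icc (0 : ℝ) T → ℝ)
    (t : Set.Icc (0 : ℝ) T) :
    ∫ s in Set.Iic t, q s ∂(timeMeasure T) = ∫ s in (0 : ℝ)..t, Set.IccExtend hT q s := by
  have he := MeasurableEmbedding.subtype_coe (measurableSet_Icc : MeasurableSet (Set.Icc (0 : ℝ) T))
  have h1 : Set.Iic t = Subtype.val ⁻¹' Set.Icc (0 : ℝ) t := by
    ext s
    simp only [Set.mem_Iic, Set.mem_preimage, Set.mem_Icc, s.2.1, true_and, Subtype.coe_le_coe]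
  rw [intervalIntegral.integral_of_le t.2.1, ← integral_Icc_eq_integral_Ioc, h1]
  have h2 : (volume : Measure ℝ).restrict (Set.Icc (0 : ℝ) t) =
      ((timeMeasure T).map Subtype.val).restrict (Set.Icc (0 : ℝ) t) := by
    rw [timeMeasure, he.map_comap, Subtype.range_coe,
      Measure.restrict_restrict_of_subset (Set.Icc_subset_Icc_right t.2.2)]
  rw [h2, he.setIntegral_map]
  simp

section Flow

variable {Y q : ℝ → ℝ} {T τ : ℝ}

/-- Ensures that the clock, once past `τ`, stays where the diffusion coefficient vanishes. -/
lemma le_of_hasDerivAt_one_le (hY : ∀ t, HasDerivAt Y (q t) t) (hq : ∀ t, 1 ≤ q t)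
    (hY0 : Y 0 = 0) {t : ℝ} (ht : 0 ≤ t) : t ≤ Y t := by
  have h : Monotone fun t => Y t - t := monotone_of_hasDerivAt_nonneg (f' := fun t => q t - 1)
    (fun t => (hY t).sub (hasDerivAt_id t)) (fun t => by simpa using hq t)
  have := h ht
  simp only [hY0] at this
  linarith

lemma sub_eq_const_of_hasDerivAt_one {F : ℝ → ℝ} {a b : ℝ} (hab : a ≤ b)
    (hF : ∀ t ∈ Set.Icc a b, HasDerivAt F 1 t) : F b - b = F a - a := by
  have hd : ∀ t ∈ Set.Icc a b, HasDerivAt (fun t => F t - t) 0 t := fun t ht => by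
    simpa using! (hF t ht).sub (hasDerivAt_id t)
  exact constant_of_has_deriv_right_zero (fun t ht => (hd t ht).continuousAt.continuousWithinAt)
    (fun t ht => (hd t (Set.Ico_subset_Icc_self ht)).hasDerivWithinAt) b ⟨hab, le_rfl⟩

lemma eq_self_of_hasDerivAt (hY : ∀ t, HasDerivAt Y (q t) t) (hq : ∀ t, 1 ≤ q t) (hY0 : Y 0 = 0)
    (hq1 : ∀ t ∈ Set.Icc 0 τ, Y t ≤ τ → q t = 1) {t : ℝ} (ht : t ∈ Set.Icc 0 τ) : Y t = t := by
  have hmono : Monotone Y := monotone_of_hasDerivAt_nonneg hY fun t => zero_le_one.trans (hq t)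
  have key : ∀ t ∈ Set.Icc 0 τ, Y t ≤ τ → Y t = t := by
    intro t ht hYt
    have := sub_eq_const_of_hasDerivAt_one (F := Y) ht.1 fun u hu =>
      hq1 u ⟨hu.1, hu.2.trans ht.2⟩ ((hmono hu.2).trans hYt) ▸ hY u
    rw [hY0] at this
    linarith
  -- If the clock were ahead at time `t ≤ τ`, it would have passed the value `τ` at some `u ≤ t`; up
  -- to then it ran at unit speed, so `u = τ`, hence `u = t`, and `Y t = τ` after all.
  by_contra hne
  have hlt : τ < Y t := by
    by_contra! h
    exact hne (key t ht h)
  have hcont : Continuous Y := continuous_iff_continuousAt.2 fun t => (hY t).continuousAt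
  obtain ⟨u, hu, hYu⟩ := intermediate_value_Icc ht.1 hcont.continuousOn
    (⟨hY0.le.trans (ht.1.trans ht.2), hlt.le⟩ : τ ∈ Set.Icc (Y 0) (Y t))
  have h1 := key u ⟨hu.1, hu.2.trans ht.2⟩ hYu.le
  have h2 : u = t := le_antisymm hu.2 (by rw [← h1, hYu]; exact ht.2)
  rw [h2] at hYu
  linarith

/-- Separation of variables: `Y - c ∫_τ^Y ρ` has derivative `q (1 - c ρ(Y)) = 1` on `[τ, T]` and
equals `τ` at time `τ`. -/
lemma implicit_of_hasDerivAt (hY : ∀ t, HasDerivAt Y (q t) t) (hτT : τ ≤ T) (hYτ : Y τ = τ)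
    {ρ : ℝ → ℝ} (hρ : Continuous ρ) {c : ℝ} (hc : ∀ y, c * ρ y ≠ 1)
    (hq : ∀ t ∈ Set.Icc τ T, q t = (1 - c * ρ (Y t))⁻¹) :
    Y T - c * (∫ x in τ..Y T, ρ x) = T := by
  have hR : ∀ y, HasDerivAt (fun y => ∫ x in τ..y, ρ x) (ρ y) y := fun y =>
    (hρ.integral_hasStrictDerivAt τ y).hasDerivAt
  have h := sub_eq_const_of_hasDerivAt_one (F := fun t => Y t - c * (∫ x in τ..Y t, ρ x)) hτT ?_
  · simp only [hYτ, intervalIntegral.integral_same] at h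
    linarith
  · intro t ht
    have h1 := (hY t).sub (((hR (Y t)).comp t (hY t)).const_mul c)
    refine h1.congr_deriv ?_
    have h2 : 1 - c * ρ (Y t) ≠ 0 := sub_ne_zero.2 (hc _).symm
    rw [hq t ht]
    field_simp

end Flow

/-! ### Lower bounds for oscillating functions of Gaussian random variables -/

section Oscillation

/-- The mean of `sin²` is `1/2`; the boundary terms of the primitive cost at most half of this once
the phase advances by `2`. -/
lemma le_integral_sin_sq {p q w θ : ℝ} (hpq : p ≤ q) (hw : 2 ≤ w * (q - p)) :
    (q - p) / 4 ≤ ∫ x in p..q, Real.sin (w * x + θ) ^ 2 := by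
  have hw0 : 0 < w := by
    by_contra! h
    nlinarith
  rw [intervalIntegral.integral_comp_mul_add (fun x => Real.sin x ^ 2) hw0.ne' θ, integral_sin_sq,
    smul_eq_mul, inv_mul_eq_div, le_div_iff₀ hw0]
  have h : ∀ x : ℝ, |Real.sin x * Real.cos x| ≤ 1 / 2 := fun x => by
    rw [abs_le]
    constructor <;> nlinarith [Real.sin_sq_add_cos_sq x, sq_nonneg (Real.sin x + Real.cos x),
      sq_nonneg (Real.sin x - Real.cos x)]
  have h1 := (abs_le.1 (h (w * p + θ))).1
  have h2 := (abs_le.1 (h (w * q + θ))).2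
  linarith

lemma le_setLIntegral_sin_sq_gaussianReal {p q w θ κ : ℝ} {v : ℝ≥0} (hv : v ≠ 0) (hpq : p ≤ q)
    (hw : 2 ≤ w * (q - p)) (hκ0 : 0 ≤ κ)
    (hκ : ∀ x ∈ Set.Icc p q, κ ≤ gaussianPDFReal 0 v x) :
    ENNReal.ofReal (κ * ((q - p) / 4)) ≤
      ∫⁻ x in Set.Icc p q, ENNReal.ofReal (Real.sin (w * x + θ) ^ 2) ∂(gaussianReal 0 v) := by
  have hcont : Continuous fun x => Real.sin (w * x + θ) ^ 2 := by fun_prop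
  rw [gaussianReal_of_var_ne_zero _ hv, setLIntegral_withDensity_eq_setLIntegral_mul _
    (measurable_gaussianPDF 0 v) hcont.measurable.ennreal_ofReal measurableSet_Icc]
  calc ENNReal.ofReal (κ * ((q - p) / 4))
      ≤ ENNReal.ofReal κ * ENNReal.ofReal (∫ x in p..q, Real.sin (w * x + θ) ^ 2) := by
        rw [ENNReal.ofReal_mul hκ0]
        gcongr
        exact le_integral_sin_sq hpq hw
    _ = ∫⁻ x in Set.Icc p q, ENNReal.ofReal κ * ENNReal.ofReal (Real.sin (w * x + θ) ^ 2) := by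
        rw [lintegral_const_mul _ hcont.measurable.ennreal_ofReal,
          intervalIntegral.integral_of_le hpq, ← integral_Icc_eq_integral_Ioc,
          ofReal_integral_eq_lintegral_ofReal hcont.integrableOn_Icc
            (.of_forall fun x => sq_nonneg _)]
    _ ≤ _ := by
        refine setLIntegral_mono' measurableSet_Icc fun x hx => ?_
        rw [Pi.mul_apply]
        gcongr
        exact ENNReal.ofReal_le_ofReal (hκ x hx)

/-- A function that oscillates with a high frequency around `k + 1/2` distinguishes `M + N` from
`M - N` for independent centred Gaussian `M` and `N`. -/
lemma exists_le_lintegral_oscillation {S : ℝ} (hS : 0 < S) :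
    ∃ κ : ℕ → ℝ, (∀ k, 0 < κ k) ∧ ∀ (k : ℕ) (v₀ w : ℝ), 0 < v₀ → 2 / min (√v₀) (1 / 8) ≤ w →
      ∀ c : ℝ → ℝ, Measurable c →
        (∀ x ∈ Set.Icc ((k : ℝ) + 1 / 4) (k + 3 / 4), c x = 1 / 4 * (1 + Real.sin (w * x))) →
      ∀ v₁ v₂ : ℝ≥0, S / 4 ≤ v₁ → v₁ ≤ 2 * S → v₀ ≤ v₂ → v₂ ≤ 2 * S →
        ENNReal.ofReal (κ k) ≤
          ∫⁻ x, ∫⁻ y, ‖c (x + y) - c (x - y)‖ₑ ∂(gaussianReal 0 v₂) ∂(gaussianReal 0 v₁) := by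
  -- Lower bound on `[k, k + 1]` for the centred Gaussian density with variance between `S / 4` and
  -- `2 S`.
  set κ₁ : ℕ → ℝ := fun k => (√(2 * Real.pi * (2 * S)))⁻¹ * Real.exp (-(2 * (k + 1) ^ 2 / S))
  -- On `[0, ℓ]` with `ℓ = min √v₂ (1/8)` the density is at least `(2π v₂)^{-1/2} e^{-1/2}`, and `ℓ
  -- / √v₂ ≥ min 1 (1 / (8 √(2S)))`. Scaling the window with the standard deviation makes the bound
  -- independent of how small `v₂` is.
  set κ₂ : ℝ := (√(2 * Real.pi))⁻¹ * Real.exp (-(1 / 2)) * (min 1 (1 / (8 * √(2 * S))) / 4)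
  have hκ₁ : ∀ k, 0 < κ₁ k := fun k => by positivity
  have hκ₂ : 0 < κ₂ := by positivity
  refine ⟨fun k => 1 / 2 * (κ₁ k * (1 / 16) * κ₂), fun k => by have := hκ₁ k; positivity, ?_⟩
  intro k v₀ w hv₀ hw c hcm hc v₁ v₂ hv₁ hv₁' hv₂ hv₂'
  have hv₁0 : (0 : ℝ) < v₁ := by linarith
  have hv₂0 : (0 : ℝ) < v₂ := by linarith
  have hmin : 0 < min (√v₀) (1 / 8) := by positivity
  have hwmin : 2 ≤ w * min (√v₀) (1 / 8) := (div_le_iff₀ hmin).1 hw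
  have hw0 : 0 < w := lt_of_lt_of_le (by positivity) hw
  have hw16 : 2 ≤ w * (1 / 8) :=
    hwmin.trans (mul_le_mul_of_nonneg_left (min_le_right _ _) hw0.le)
  -- The cap `1/8` keeps `x ± y` in `[k + 1/4, k + 3/4]` for `x ∈ [k + 3/8, k + 5/8]`.
  set ℓ := min (√v₂) (1 / 8) with hℓ
  have hℓ0 : 0 < ℓ := by positivity
  have hwℓ : 2 ≤ w * (ℓ - 0) := by
    rw [sub_zero]
    refine hwmin.trans (mul_le_mul_of_nonneg_left (min_le_min_right _ ?_) hw0.le)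
    exact Real.sqrt_le_sqrt hv₂
  have hM : ENNReal.ofReal (κ₁ k * (1 / 16)) ≤
      ∫⁻ x in Set.Icc ((k : ℝ) + 3 / 8) (k + 5 / 8), ENNReal.ofReal (Real.cos (w * x) ^ 2)
        ∂(gaussianReal 0 v₁) := by
    have h := le_setLIntegral_sin_sq_gaussianReal (p := (k : ℝ) + 3 / 8) (q := k + 5 / 8) (w := w)
      (θ := Real.pi / 2) (κ := κ₁ k) (v := v₁) (by exact_mod_cast hv₁0.ne') (by linarith)
      (by linarith) (hκ₁ k).le ?_
    · simp only [Real.sin_add_pi_div_two] at h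
      convert h using 3
      ring
    · intro x hx
      have hx0 : 0 ≤ x := by linarith [hx.1, (Nat.cast_nonneg k : (0 : ℝ) ≤ k)]
      have hx1 : x ≤ k + 1 := by linarith [hx.2]
      rw [gaussianPDFReal, sub_zero]
      simp only [κ₁]
      refine mul_le_mul (by gcongr) (Real.exp_le_exp.2 ?_) (Real.exp_nonneg _) (by positivity)
      rw [neg_div]
      apply neg_le_neg
      rw [div_le_div_iff₀ (by positivity) hS]
      have h1 : x ^ 2 ≤ (k + 1) ^ 2 := by gcongr
      nlinarith [sq_nonneg x]
  have hN : ENNReal.ofReal κ₂ ≤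
      ∫⁻ y in Set.Icc 0 ℓ, ENNReal.ofReal (Real.sin (w * y) ^ 2) ∂(gaussianReal 0 v₂) := by
    have h := le_setLIntegral_sin_sq_gaussianReal (p := 0) (q := ℓ) (w := w)
      (θ := 0) (κ := (√(2 * Real.pi * v₂))⁻¹ * Real.exp (-(1 / 2))) (v := v₂)
      (by exact_mod_cast hv₂0.ne') hℓ0.le hwℓ (by positivity) ?_
    · simp only [add_zero] at h
      refine le_trans (ENNReal.ofReal_le_ofReal ?_) h
      have h1 : min 1 (1 / (8 * √(2 * S))) ≤ (√v₂)⁻¹ * ℓ := by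
        have hs : 0 < √(v₂ : ℝ) := by positivity
        rw [hℓ, mul_min_of_nonneg _ _ (by positivity), inv_mul_cancel₀ hs.ne']
        refine min_le_min_left _ ?_
        rw [inv_mul_eq_div, div_div]
        gcongr
      rw [sub_zero, Real.sqrt_mul (by positivity), mul_inv]
      calc κ₂ ≤ (√(2 * Real.pi))⁻¹ * Real.exp (-(1 / 2)) * ((√v₂)⁻¹ * ℓ / 4) := by
            simp only [κ₂]
            gcongr
        _ = _ := by ring
    · intro y hy
      rw [gaussianPDFReal, sub_zero]
      refine mul_le_mul_of_nonneg_left (Real.exp_le_exp.2 ?_) (by positivity)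
      rw [neg_div]
      apply neg_le_neg
      rw [div_le_div_iff₀ (by positivity) (by positivity)]
      have h1 : y ^ 2 ≤ v₂ := by
        rw [← Real.sq_sqrt hv₂0.le]
        exact pow_le_pow_left₀ hy.1 (hy.2.trans (min_le_left _ _)) 2
      linarith
  have hpt : ∀ x ∈ Set.Icc ((k : ℝ) + 3 / 8) (k + 5 / 8), ∀ y ∈ Set.Icc 0 ℓ,
      ENNReal.ofReal (1 / 2 * Real.cos (w * x) ^ 2) * ENNReal.ofReal (Real.sin (w * y) ^ 2) ≤
        ‖c (x + y) - c (x - y)‖ₑ := by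
    intro x hx y hy
    have hy8 : y ≤ 1 / 8 := hy.2.trans (min_le_right _ _)
    have hy0 := hy.1
    rw [hc (x + y) ⟨by linarith [hx.1], by linarith [hx.2]⟩,
      hc (x - y) ⟨by linarith [hx.1], by linarith [hx.2]⟩, ← ENNReal.ofReal_mul (by positivity),
      Real.enorm_eq_ofReal_abs]
    apply ENNReal.ofReal_le_ofReal
    -- The difference factorizes in `x` and `y`. Afterwards `|cos|` and `|sin|` are bounded below by
    -- their squares, whose integrals are explicit.
    have h1 : 1 / 4 * (1 + Real.sin (w * (x + y))) - 1 / 4 * (1 + Real.sin (w * (x - y))) =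
        1 / 2 * (Real.cos (w * x) * Real.sin (w * y)) := by
      rw [mul_add w, mul_sub w, Real.sin_add, Real.sin_sub]
      ring
    rw [h1, abs_mul, abs_of_pos (by norm_num : (0 : ℝ) < 1 / 2), mul_assoc, abs_mul,
      ← sq_abs (Real.cos _), ← sq_abs (Real.sin _)]
    gcongr
    · exact pow_le_of_le_one (abs_nonneg _) (Real.abs_cos_le_one _) two_ne_zero
    · exact pow_le_of_le_one (abs_nonneg _) (Real.abs_sin_le_one _) two_ne_zero
  calc ENNReal.ofReal (1 / 2 * (κ₁ k * (1 / 16) * κ₂))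
      = ENNReal.ofReal (1 / 2) * ENNReal.ofReal (κ₁ k * (1 / 16)) * ENNReal.ofReal κ₂ := by
        have := (hκ₁ k).le
        rw [← ENNReal.ofReal_mul (by norm_num), ← ENNReal.ofReal_mul (by positivity)]
        congr 1
        ring
    _ ≤ ENNReal.ofReal (1 / 2) * (∫⁻ x in Set.Icc ((k : ℝ) + 3 / 8) (k + 5 / 8),
          ENNReal.ofReal (Real.cos (w * x) ^ 2) ∂(gaussianReal 0 v₁)) *
          ∫⁻ y in Set.Icc 0 ℓ, ENNReal.ofReal (Real.sin (w * y) ^ 2) ∂(gaussianReal 0 v₂) := by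
        gcongr
    _ = ∫⁻ x in Set.Icc ((k : ℝ) + 3 / 8) (k + 5 / 8), ∫⁻ y in Set.Icc 0 ℓ,
          ENNReal.ofReal (1 / 2 * Real.cos (w * x) ^ 2) * ENNReal.ofReal (Real.sin (w * y) ^ 2)
          ∂(gaussianReal 0 v₂) ∂(gaussianReal 0 v₁) := by
        simp_rw [lintegral_const_mul' _ _ ENNReal.ofReal_ne_top]
        rw [lintegral_mul_const _ (by fun_prop), ← lintegral_const_mul' _ _ ENNReal.ofReal_ne_top]
        simp_rw [ENNReal.ofReal_mul (by norm_num : (0 : ℝ) ≤ 1 / 2)]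
    _ ≤ ∫⁻ x in Set.Icc ((k : ℝ) + 3 / 8) (k + 5 / 8), ∫⁻ y in Set.Icc 0 ℓ,
          ‖c (x + y) - c (x - y)‖ₑ ∂(gaussianReal 0 v₂) ∂(gaussianReal 0 v₁) :=
        setLIntegral_mono' measurableSet_Icc fun x hx =>
          setLIntegral_mono' measurableSet_Icc fun y hy => hpt x hx y hy
    _ ≤ _ := (lintegral_mono fun x => setLIntegral_le_lintegral _ _).trans
        (setLIntegral_le_lintegral _ _)

/-- Reflection principle: if `N` is a centred Gaussian random variable that is independent of
`(U, M)`, then no `U` approximates `c (M + N)` well. -/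
lemma lintegral_reflection_le {Ω : Type*} {mΩ : MeasurableSpace Ω} {P : Measure Ω}
    [IsProbabilityMeasure P] {U M N : Ω → ℝ} (hU : AEMeasurable U P) {v₁ v₂ : ℝ≥0}
    (hM : HasLaw M (gaussianReal 0 v₁) P) (hN : HasLaw N (gaussianReal 0 v₂) P)
    (hind : IndepFun (fun ω => (U ω, M ω)) N P) {c : ℝ → ℝ} (hc : Measurable c) :
    ∫⁻ x, ∫⁻ y, ‖c (x + y) - c (x - y)‖ₑ ∂(gaussianReal 0 v₂) ∂(gaussianReal 0 v₁) ≤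
      2 * ∫⁻ ω, ‖c (M ω + N ω) - U ω‖ₑ ∂P := by
  have hUM : AEMeasurable (fun ω => (U ω, M ω)) P := hU.prodMk hM.aemeasurable
  have hmap := (indepFun_iff_map_prod_eq_prod_map_map hUM hN.aemeasurable).1 hind
  set ν := P.map fun ω => (U ω, M ω) with hν
  have : IsProbabilityMeasure ν := Measure.isProbabilityMeasure_map hUM
  have hlaw : ∫⁻ ω, ‖c (M ω + N ω) - U ω‖ₑ ∂P =
      ∫⁻ z, ∫⁻ y, ‖c (z.2 + y) - z.1‖ₑ ∂(gaussianReal 0 v₂) ∂ν := by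
    have hmeas : Measurable fun z : (ℝ × ℝ) × ℝ => ‖c (z.1.2 + z.2) - z.1.1‖ₑ := by fun_prop
    rw [← lintegral_prod _ hmeas.aemeasurable, ← hN.map_eq, ← hmap,
      lintegral_map' hmeas.aemeasurable (hUM.prodMk hN.aemeasurable)]
  -- The reflection `N ↦ -N` preserves the law of `N` and, by independence, the joint law with `(U,
  -- M)`.
  have hneg : ∀ z : ℝ × ℝ, ∫⁻ y, ‖c (z.2 + y) - z.1‖ₑ ∂(gaussianReal 0 v₂) =
      ∫⁻ y, ‖c (z.2 - y) - z.1‖ₑ ∂(gaussianReal 0 v₂) := by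
    intro z
    have h : (gaussianReal 0 v₂).map (fun y => -y) = gaussianReal 0 v₂ := by
      rw [gaussianReal_map_neg, neg_zero]
    conv_lhs => rw [← h]
    rw [lintegral_map (by fun_prop) measurable_neg]
    simp_rw [← sub_eq_add_neg]
  have hMν : gaussianReal 0 v₁ = ν.map Prod.snd := by
    rw [hν, AEMeasurable.map_map_of_aemeasurable measurable_snd.aemeasurable hUM, ← hM.map_eq]
    rfl
  have hmeas : Measurable fun x => ∫⁻ y, ‖c (x + y) - c (x - y)‖ₑ ∂(gaussianReal 0 v₂) :=
    Measurable.lintegral_prod_right' (f := fun z : ℝ × ℝ => ‖c (z.1 + z.2) - c (z.1 - z.2)‖ₑ)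
      (by fun_prop)
  rw [hMν, lintegral_map hmeas measurable_snd, hlaw, ← lintegral_const_mul' _ _ (by simp)]
  refine lintegral_mono fun z => ?_
  calc ∫⁻ y, ‖c (z.2 + y) - c (z.2 - y)‖ₑ ∂(gaussianReal 0 v₂)
      ≤ ∫⁻ y, (‖c (z.2 + y) - z.1‖ₑ + ‖c (z.2 - y) - z.1‖ₑ) ∂(gaussianReal 0 v₂) := by
        refine lintegral_mono fun y => ?_
        rw [← sub_sub_sub_cancel_right (c (z.2 + y)) (c (z.2 - y)) z.1]
        exact enorm_sub_le
    _ = 2 * ∫⁻ y, ‖c (z.2 + y) - z.1‖ₑ ∂(gaussianReal 0 v₂) := by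
        rw [lintegral_add_left (by fun_prop), ← hneg, two_mul]

end Oscillation

/-! ### The oscillating coefficient -/

/-- A smooth function which equals `(1 + sin (w k x)) / 4` on `[k + 1/4, k + 3/4]`. -/
lemma exists_contDiff_oscillation (w : ℕ → ℝ) :
    ∃ c : ℝ → ℝ, ContDiff ℝ (⊤ : ℕ∞) c ∧ (∀ x, c x ∈ Set.Icc 0 (1 / 2)) ∧
      ∀ (k : ℕ), ∀ x ∈ Set.Icc ((k : ℝ) + 1 / 4) (k + 3 / 4),
        c x = 1 / 4 * (1 + Real.sin (w k * x)) := by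
  -- `β` is `1` on `[1/4, 3/4]` and `0` within `1/8` of the end points of the unit interval, so the
  -- pieces with different frequencies are glued across the integers by the constant `1/4`.
  let β : ContDiffBump (1 / 2 : ℝ) := ⟨1 / 4, 3 / 8, by norm_num, by norm_num⟩
  have hβ0 : ∀ x : ℝ, 3 / 8 ≤ |x - 1 / 2| → β x = 0 := fun x hx => β.zero_of_le_dist hx
  let c : ℝ → ℝ := fun x => 1 / 4 * (1 + β (Int.fract x) * Real.sin (w ⌊x⌋.toNat * x))
  have hfloor : ∀ (n : ℤ) (x : ℝ), x ∈ Set.Ioo (n : ℝ) (n + 1) → ⌊x⌋ = n := fun n x hx =>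
    Int.floor_eq_iff.2 ⟨hx.1.le, hx.2⟩
  refine ⟨c, contDiff_iff_contDiffAt.2 fun x => ?_, fun x => ?_, fun k x hx => ?_⟩
  · by_cases hx : Int.fract x = 0
    · have hxn : (⌊x⌋ : ℝ) = x := by rw [← Int.self_sub_fract, hx, sub_zero]
      have hev : c =ᶠ[𝓝 x] fun _ => 1 / 4 := by
        filter_upwards [Ioo_mem_nhds (show x - 1 / 8 < x by linarith)
          (show x < x + 1 / 8 by linarith)] with y hy
        have : β (Int.fract y) = 0 := by
          apply hβ0
          rcases lt_or_ge y x with h | h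
          · have : ⌊y⌋ = ⌊x⌋ - 1 := Int.floor_eq_iff.2 (by
              push_cast; constructor <;> linarith [hy.1])
            rw [Int.fract, this, abs_of_nonneg] <;> push_cast <;> linarith [hy.1]
          · have : ⌊y⌋ = ⌊x⌋ := Int.floor_eq_iff.2 (by constructor <;> linarith [hy.2])
            rw [Int.fract, this, abs_of_nonpos] <;> linarith [hy.2]
        simp [c, this]
      exact contDiffAt_const.congr_of_eventuallyEq hev
    · have hpos : 0 < Int.fract x := lt_of_le_of_ne (Int.fract_nonneg x) (Ne.symm hx)
      have hlt := Int.fract_lt_one x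
      have hself := Int.self_sub_floor x
      have hev : c =ᶠ[𝓝 x] fun y =>
          1 / 4 * (1 + β (y - ⌊x⌋) * Real.sin (w ⌊x⌋.toNat * y)) := by
        filter_upwards [Ioo_mem_nhds (show (⌊x⌋ : ℝ) < x by linarith)
          (show x < ⌊x⌋ + 1 by linarith)] with y hy
        simp only [c, Int.fract, hfloor _ _ hy]
      refine ContDiffAt.congr_of_eventuallyEq ?_ hev
      have h1 : ContDiff ℝ (⊤ : ℕ∞) fun y : ℝ => β (y - ⌊x⌋) :=
        β.contDiff.comp (contDiff_id.sub contDiff_const)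
      have h2 : ContDiff ℝ (⊤ : ℕ∞) fun y : ℝ => Real.sin (w ⌊x⌋.toNat * y) :=
        Real.contDiff_sin.comp (contDiff_const.mul contDiff_id)
      exact (contDiff_const.mul (contDiff_const.add (h1.mul h2))).contDiffAt
  · have h : |β (Int.fract x) * Real.sin (w ⌊x⌋.toNat * x)| ≤ 1 := by
      rw [abs_mul, abs_of_nonneg β.nonneg]
      exact mul_le_one₀ β.le_one (abs_nonneg _) (Real.abs_sin_le_one _)
    have := abs_le.1 h
    simp only [c, Set.mem_Icc]
    constructor <;> linarith [this.1, this.2]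
  · have hfl : ⌊x⌋ = (k : ℤ) := hfloor k x ⟨by push_cast; linarith [hx.1], by
      push_cast; linarith [hx.2]⟩
    have h1 : β (Int.fract x) = 1 := by
      refine β.one_of_mem_closedBall ?_
      rw [Metric.mem_closedBall, Real.dist_eq, Int.fract, hfl, abs_le]
      push_cast
      constructor <;> linarith [hx.1, hx.2]
    simp only [c, h1, hfl, one_mul, Int.toNat_natCast]

/-! ### Selection of the frequency bands -/

/-- Since `κ k` may be arbitrarily small, a high band is allowed only once `δ n` is small. Taking
the largest admissible band sends `K n` to infinity. -/
lemma exists_selection {δ : ℕ → ℝ} (hδ : limsup (fun n => (δ n : EReal)) atTop ≤ 0)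
    {κ : ℕ → ℝ} (hκ : ∀ k, 0 < κ k) :
    ∃ A : ℝ, 0 < A ∧ ∃ K : ℕ → ℕ, (∀ n, δ n ≤ A * κ (K n)) ∧ ∀ k, {n | K n = k}.Finite := by
  have hev : ∀ η > 0, ∀ᶠ n in atTop, δ n < η := fun η hη => by
    have : limsup (fun n => (δ n : EReal)) atTop < (η : EReal) :=
      hδ.trans_lt (by exact_mod_cast hη)
    filter_upwards [eventually_lt_of_limsup_lt this] with n hn
    exact_mod_cast hn
  obtain ⟨D, hD⟩ : ∃ D, ∀ n, δ n ≤ D := by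
    obtain ⟨n₀, hn₀⟩ := eventually_atTop.1 (hev 1 one_pos)
    refine ⟨1 + ∑ n ∈ Finset.range n₀, |δ n|, fun n => ?_⟩
    have hs : 0 ≤ ∑ n ∈ Finset.range n₀, |δ n| := Finset.sum_nonneg fun _ _ => abs_nonneg _
    rcases lt_or_ge n n₀ with h | h
    · have := Finset.single_le_sum (f := fun n => |δ n|) (fun _ _ => abs_nonneg _)
        (Finset.mem_range.2 h)
      linarith [le_abs_self (δ n)]
    · linarith [hn₀ n h]
  -- Large enough for band `0` to be admissible for every `n`.
  set A := (|D| + 1) / κ 0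
  have hA : 0 < A := div_pos (by positivity) (hκ 0)
  have h0 : ∀ n, δ n ≤ A * κ 0 := fun n => by
    rw [div_mul_cancel₀ _ (hκ 0).ne']
    linarith [hD n, le_abs_self D]
  classical
  refine ⟨A, hA, fun n => Nat.findGreatest (fun k => δ n ≤ A * κ k) n,
    fun n => Nat.findGreatest_spec (P := fun k => δ n ≤ A * κ k) (Nat.zero_le n) (h0 n),
    fun k => ?_⟩
  -- For large `n` the band `k + 1` is admissible too, so `K n = k` is no longer possible.
  obtain ⟨n₀, hn₀⟩ := eventually_atTop.1 (hev (A * κ (k + 1)) (mul_pos hA (hκ _)))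
  refine (Set.finite_lt_nat (max n₀ (k + 1))).subset fun n hn => ?_
  by_contra! hlt
  have hlt' : max n₀ (k + 1) ≤ n := not_lt.1 hlt
  have := Nat.le_findGreatest (P := fun k => δ n ≤ A * κ k) ((le_max_right _ _).trans hlt')
    (hn₀ n ((le_max_left _ _).trans hlt')).le
  have hn' : Nat.findGreatest (fun k => δ n ≤ A * κ k) n = k := hn
  omega

lemma exists_majorant_of_finite_fibers {K : ℕ → ℕ} (hK : ∀ k, {n | K n = k}.Finite) (g : ℕ → ℝ) :
    ∃ w : ℕ → ℝ, ∀ n, g n ≤ w (K n) := by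
  have h := fun k => ((hK k).image g).bddAbove
  choose w hw using h
  exact ⟨w, fun n => hw (K n) ⟨n, rfl, rfl⟩⟩

/-! ### Continuous paths as random variables -/

/-- A random continuous function on a compact metric space is Borel measurable if its evaluations
are measurable. -/
lemma measurable_continuousMap_of_eval {Ω K E : Type*} {mΩ : MeasurableSpace Ω} [MetricSpace K]
    [CompactSpace K] [NormedAddCommGroup E] [SecondCountableTopology E] [MeasurableSpace E]
    [BorelSpace E] {F : Ω → C(K, E)} (hF : ∀ t, Measurable fun ω => F ω t) :
    Measurable[mΩ, borel C(K, E)] F := by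
  borelize C(K, E)
  have hball : ∀ (g : C(K, E)) (r : ℝ), MeasurableSet (F ⁻¹' Metric.closedBall g r) := by
    intro g r
    rcases lt_or_ge r 0 with hr | hr
    · simp [Metric.closedBall_eq_empty.2 hr]
    obtain ⟨D, hDc, hDd⟩ := TopologicalSpace.exists_countable_dense K
    -- By continuity the uniform distance is controlled on a countable dense set; separability of
    -- `C(K, E)` then writes open sets as countable unions of closed balls.
    have : F ⁻¹' Metric.closedBall g r = ⋂ t ∈ D, {ω | ‖F ω t - g t‖ ≤ r} := by
      ext ω
      simp only [Set.mem_preimage, Metric.mem_closedBall, ContinuousMap.dist_le hr,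
        Set.mem_iInter, Set.mem_ofPred_eq, ← dist_eq_norm]
      refine ⟨fun h t _ => h t, fun h t => ?_⟩
      have hcl : IsClosed {t | dist (F ω t) (g t) ≤ r} :=
        isClosed_le (by fun_prop) continuous_const
      exact hcl.closure_subset_iff.2 h (hDd t)
    rw [this]
    exact MeasurableSet.biInter hDc fun t _ =>
      measurableSet_le ((hF t).sub_const _).norm measurable_const
  refine measurable_of_isOpen fun O hO => ?_
  obtain ⟨s, hsc, hs⟩ := TopologicalSpace.exists_countable_dense C(K, E)
  have hO' : O = ⋃ p ∈ {p : C(K, E) × ℚ | p.1 ∈ s ∧ Metric.closedBall p.1 (p.2 : ℝ) ⊆ O},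
      Metric.closedBall p.1 (p.2 : ℝ) := by
    refine Set.Subset.antisymm (fun f hf => ?_) (Set.iUnion₂_subset fun p hp => hp.2)
    obtain ⟨η, hη, hηO⟩ := Metric.isOpen_iff.1 hO f hf
    obtain ⟨q, hq1, hq2⟩ := exists_rat_btwn (show (0 : ℝ) < η / 2 by linarith)
    obtain ⟨g, hgs, hg⟩ := hs.exists_dist_lt f hq1
    refine Set.mem_biUnion (x := (g, q)) ⟨hgs, fun h hh => hηO ?_⟩ hg.le
    rw [Metric.mem_closedBall] at hh
    rw [Metric.mem_ball]
    linarith [dist_triangle h g f, dist_comm f g]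
  rw [hO', Set.preimage_iUnion₂]
  have hcount : {p : C(K, E) × ℚ | p.1 ∈ s ∧ Metric.closedBall p.1 (p.2 : ℝ) ⊆ O}.Countable :=
    (hsc.prod (Set.countable_univ (α := ℚ))).mono fun p hp =>
      Set.mem_prod.2 ⟨hp.1, Set.mem_univ _⟩
  exact MeasurableSet.biUnion hcount fun p _ => hball _ _

/-! ### Reading off the oscillating coefficient from the solution -/

/-- Solving the implicit equation gives `c = (y - T) / R y` with `R y = ∫_τ^y ρ ≥ R T > 0`, which is
Lipschitz in `y` on `[T, 2T]`. -/
lemma exists_lipschitz_readout {ρ : ℝ → ℝ} (hρ : Continuous ρ) (hρ0 : ∀ x, 0 ≤ ρ x)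
    (hρ1 : ∀ x, ρ x ≤ 1) {τ T : ℝ} (hT : 0 < T) (hR : 0 < ∫ x in τ..T, ρ x) :
    ∃ L : ℝ, 0 < L ∧ ∃ Θ : ℝ → ℝ, Measurable Θ ∧ ∀ c y, T ≤ y → y ≤ 2 * T →
      y - c * (∫ x in τ..y, ρ x) = T → ∀ u, |c - Θ u| ≤ L * |y - u| := by
  set R : ℝ → ℝ := fun y => ∫ x in τ..y, ρ x with hRdef
  have hint : ∀ a b, IntervalIntegrable ρ volume a b := fun a b => hρ.intervalIntegrable a b
  have hsub : ∀ a b, R b - R a = ∫ x in a..b, ρ x := fun a b =>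
    intervalIntegral.integral_interval_sub_left (hint _ _) (hint _ _)
  have hmono : ∀ a b, a ≤ b → R a ≤ R b := fun a b hab => by
    have := intervalIntegral.integral_nonneg (μ := volume) hab fun x _ => hρ0 x
    linarith [hsub a b]
  have hlip : ∀ a b, |R b - R a| ≤ |b - a| := fun a b => by
    rw [hsub]
    have := intervalIntegral.norm_integral_le_of_norm_le_const (a := a) (b := b) (f := ρ) (C := 1)
      fun x _ => by rw [Real.norm_eq_abs, abs_of_nonneg (hρ0 x)]; exact hρ1 x
    simpa using this
  have hRcont : Continuous R := continuous_iff_continuousAt.2 fun y =>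
    (hρ.integral_hasStrictDerivAt τ y).hasDerivAt.continuousAt
  -- Estimates outside `[T, 2T]` are projected onto it: this does not increase the distance to `y`
  -- and keeps `R` away from zero.
  set pr : ℝ → ℝ := fun u => max T (min u (2 * T))
  have hprT : ∀ u, T ≤ pr u := fun u => le_max_left _ _
  have hpr2T : ∀ u, pr u ≤ 2 * T := fun u => max_le (by linarith) (min_le_right _ _)
  refine ⟨1 / R T + T / R T ^ 2, by positivity, fun u => (pr u - T) / R (pr u), ?_, ?_⟩
  · have : Measurable pr := by fun_prop
    exact (this.sub_const T).div (hRcont.measurable.comp this)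
  intro c y hTy hy2T hc u
  have hRy : R T ≤ R y := hmono _ _ hTy
  have hRu : R T ≤ R (pr u) := hmono _ _ (hprT u)
  have hRy0 : 0 < R y := hR.trans_le hRy
  have hRu0 : 0 < R (pr u) := hR.trans_le hRu
  have hcy : c = (y - T) / R y := by
    rw [eq_div_iff hRy0.ne']
    linarith
  have hpr : |y - pr u| ≤ |y - u| := by
    have hy : pr y = y := by
      simp only [pr]
      rw [min_eq_left hy2T, max_eq_right hTy]
    have := abs_max_sub_max_le_abs (min y (2 * T)) (min u (2 * T)) T
    rw [max_comm _ T, max_comm _ T] at this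
    have h2 := abs_min_sub_min_le_max y (2 * T) u (2 * T)
    rw [sub_self, abs_zero, max_eq_left (abs_nonneg _)] at h2
    calc |y - pr u| = |pr y - pr u| := by rw [hy]
      _ ≤ _ := this.trans h2
  have hid : c - (pr u - T) / R (pr u) =
      (y - pr u) / R y + (pr u - T) * (R (pr u) - R y) / (R y * R (pr u)) := by
    rw [hcy]
    field_simp
    ring
  rw [hid]
  have h1 : |(y - pr u) / R y| ≤ |y - u| / R T := by
    rw [abs_div, abs_of_pos hRy0]
    gcongr
  have h2 : |(pr u - T) * (R (pr u) - R y) / (R y * R (pr u))| ≤ T * |y - u| / (R T * R T) := by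
    rw [abs_div, abs_mul, abs_of_pos (mul_pos hRy0 hRu0),
      abs_of_nonneg (sub_nonneg.2 (hprT u))]
    have h3 : |R (pr u) - R y| ≤ |y - u| := (hlip _ _).trans ((abs_sub_comm _ _).trans_le hpr)
    have h4 : pr u - T ≤ T := by linarith [hpr2T u]
    exact div_le_div₀ (by positivity) (mul_le_mul h4 h3 (abs_nonneg _) hT.le) (by positivity)
      (mul_le_mul hRy hRu hR.le hRy0.le)
  calc _ ≤ |y - u| / R T + T * |y - u| / (R T * R T) := (abs_add_le _ _).trans (add_le_add h1 h2)
    _ = _ := by ring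

/-! ### Variance of the bridge component -/

lemma setIntegral_Ioc_timeMeasure {T : ℝ} (f : ℝ → ℝ) {a b : Set.Icc (0 : ℝ) T} (hab : a ≤ b) :
    ∫ s in Set.Ioc a b, f s ∂(timeMeasure T) = ∫ x in (a : ℝ)..b, f x := by
  have he := MeasurableEmbedding.subtype_coe (measurableSet_Icc : MeasurableSet (Set.Icc (0 : ℝ) T))
  have h1 : Set.Ioc a b = Subtype.val ⁻¹' Set.Ioc (a : ℝ) b := by
    ext s
    simp only [Set.mem_Ioc, Set.mem_preimage, Subtype.coe_lt_coe, Subtype.coe_le_coe]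
  rw [intervalIntegral.integral_of_le hab, h1]
  have h2 : (volume : Measure ℝ).restrict (Set.Ioc (a : ℝ) b) =
      ((timeMeasure T).map Subtype.val).restrict (Set.Ioc (a : ℝ) b) := by
    rw [timeMeasure, he.map_comap, Subtype.range_coe, Measure.restrict_restrict_of_subset
      (Set.Ioc_subset_Icc_self.trans (Set.Icc_subset_Icc a.2.1 b.2.2))]
  rw [h2, he.setIntegral_map]

lemma sq_intervalIntegral_le {f : ℝ → ℝ} (hf : Continuous f) {a b : ℝ} (hab : a < b) :
    (∫ x in a..b, f x) ^ 2 ≤ (b - a) * ∫ x in a..b, f x ^ 2 := by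
  set A := ∫ x in a..b, f x
  have hba : 0 < b - a := sub_pos.2 hab
  have h : 0 ≤ ∫ x in a..b, (f x - A / (b - a)) ^ 2 :=
    intervalIntegral.integral_nonneg hab.le fun x _ => sq_nonneg _
  have h2 : ∫ x in a..b, (f x - A / (b - a)) ^ 2 =
      (∫ x in a..b, f x ^ 2) - 2 * (A / (b - a)) * A + (b - a) * (A / (b - a)) ^ 2 := by
    have hi1 : IntervalIntegrable (fun x => f x ^ 2) volume a b :=
      (hf.pow 2).intervalIntegrable a b
    have hi2 : IntervalIntegrable (fun x => 2 * (A / (b - a)) * f x) volume a b :=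
      (hf.const_mul _).intervalIntegrable a b
    simp_rw [show ∀ x, (f x - A / (b - a)) ^ 2 =
      f x ^ 2 - 2 * (A / (b - a)) * f x + (A / (b - a)) ^ 2 from fun x => by ring]
    rw [intervalIntegral.integral_add (hi1.sub hi2) intervalIntegrable_const,
      intervalIntegral.integral_sub hi1 hi2, intervalIntegral.integral_const_mul,
      intervalIntegral.integral_const, smul_eq_mul]
  rw [h2] at h
  have h3 : 2 * (A / (b - a)) * A - (b - a) * (A / (b - a)) ^ 2 = A ^ 2 / (b - a) := by
    field_simp
    ring
  have h4 : A ^ 2 / (b - a) ≤ ∫ x in a..b, f x ^ 2 := by linarith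
  rwa [div_le_iff₀ hba, mul_comm] at h4

/-- The left side will be the variance of the component `N`. Monotonicity puts the second integral
between `0` and the first, and Cauchy–Schwarz on `[a, p]` leaves a factor `1/2`. So the remainder
`M` cannot degenerate. -/
lemma bridge_le_half {f : ℝ → ℝ} (hf : Continuous f) (hf0 : ∀ x, 0 ≤ f x) (hanti : Antitone f)
    {a p b : ℝ} (hap : a < p) (hmid : p - a = b - p) :
    (1 / 2 * ((∫ x in a..p, f x) - ∫ x in p..b, f x)) ^ 2 / ((b - a) / 4) ≤
      (∫ x in a..p, f x ^ 2) / 2 := by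
  have hpb : p < b := by linarith
  have hB : 0 ≤ ∫ x in p..b, f x := intervalIntegral.integral_nonneg hpb.le fun x _ => hf0 x
  have hshift : ∫ x in p..b, f x = ∫ x in a..p, f (x + (p - a)) := by
    rw [intervalIntegral.integral_comp_add_right]
    congr 1 <;> linarith
  have hBA : ∫ x in p..b, f x ≤ ∫ x in a..p, f x := by
    rw [hshift]
    exact intervalIntegral.integral_mono_on hap.le
      ((hf.comp (continuous_add_const _)).intervalIntegrable _ _) (hf.intervalIntegrable _ _)
      fun x _ => hanti (by linarith)
  have h1 := sq_intervalIntegral_le hf hap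
  have h2 : (1 / 2 * ((∫ x in a..p, f x) - ∫ x in p..b, f x)) ^ 2 ≤
      1 / 4 * (∫ x in a..p, f x) ^ 2 := by nlinarith
  rw [div_le_iff₀ (by linarith)]
  have : b - a = 2 * (p - a) := by linarith
  rw [this]
  linarith

/-- The bound must be uniform over all gaps of length at least `ε`. It comes from the minimum of `f
x - f (x + ε/2)` on a compact interval, positive by strict monotonicity. -/
lemma exists_le_bridge {f : ℝ → ℝ} (hf : Continuous f) (hanti : Antitone f) {τ : ℝ}
    (hstrict : StrictAntiOn f (Set.Icc 0 τ)) {ε : ℝ} (hε : ε ∈ Set.Ioc 0 τ) :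
    ∃ v > 0, ∀ a p b : ℝ, 0 ≤ a → b ≤ τ → ε ≤ b - a → p - a = b - p →
      0 ≤ (∫ x in a..p, f x) - ∫ x in p..b, f x ∧
      v ≤ (1 / 2 * ((∫ x in a..p, f x) - ∫ x in p..b, f x)) ^ 2 / ((b - a) / 4) := by
  obtain ⟨x₀, hx₀, hmin⟩ := (isCompact_Icc (a := (0 : ℝ)) (b := τ - ε / 2)).exists_isMinOn
    ⟨0, le_rfl, by linarith [hε.1, hε.2]⟩
    (hf.sub (hf.comp (continuous_add_const (ε / 2)))).continuousOn
  set κ := f x₀ - f (x₀ + ε / 2)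
  have hε0 : 0 < ε := hε.1
  have hκ : 0 < κ := sub_pos.2 (hstrict ⟨hx₀.1, by linarith [hx₀.2]⟩
    ⟨by linarith [hx₀.1], by linarith [hx₀.2]⟩ (by linarith))
  -- The difference of the integrals is at least `(p - a) κ`; the quotient is then at least `(p - a)
  -- κ² / 2`, and `p - a ≥ ε / 2`.
  refine ⟨ε * κ ^ 2 / 4, by positivity, fun a p b ha hb hab hmid => ?_⟩
  have hap : a < p := by linarith
  have hshift : ∫ x in p..b, f x = ∫ x in a..p, f (x + (p - a)) := by
    rw [intervalIntegral.integral_comp_add_right]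
    congr 1 <;> linarith
  have hi : IntervalIntegrable (fun x => f (x + (p - a))) volume a p :=
    (hf.comp (continuous_add_const (p - a))).intervalIntegrable a p
  have h1 : (p - a) * κ ≤ (∫ x in a..p, f x) - ∫ x in p..b, f x := by
    rw [hshift, ← intervalIntegral.integral_sub (hf.intervalIntegrable _ _) hi, ← smul_eq_mul,
      ← intervalIntegral.integral_const]
    refine intervalIntegral.integral_mono_on hap.le intervalIntegrable_const
      ((hf.intervalIntegrable _ _).sub hi) fun x hx => ?_
    have h2 : κ ≤ f x - f (x + ε / 2) := hmin ⟨ha.trans hx.1, by linarith [hx.2]⟩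
    have h3 : f (x + (p - a)) ≤ f (x + ε / 2) := hanti (by linarith)
    linarith
  have hpos : 0 ≤ (p - a) * κ := mul_nonneg (by linarith) hκ.le
  refine ⟨hpos.trans h1, ?_⟩
  have hba : b - a = 2 * (p - a) := by linarith
  rw [le_div_iff₀ (by linarith), hba, mul_pow]
  have h4 : ((p - a) * κ) ^ 2 ≤ ((∫ x in a..p, f x) - ∫ x in p..b, f x) ^ 2 :=
    pow_le_pow_left₀ hpos h1 2
  have h5 : ε * κ ^ 2 * (p - a) ≤ 2 * ((p - a) * κ) ^ 2 := by
    have : ε * ((p - a) * κ ^ 2) ≤ 2 * (p - a) * ((p - a) * κ ^ 2) := by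
      have h0 : 0 ≤ (p - a) * κ ^ 2 := mul_nonneg (by linarith) (sq_nonneg _)
      exact mul_le_mul_of_nonneg_right (by linarith) h0
    linarith
  linarith

section BridgeIntegrals

variable {T : ℝ} {a p b t : Set.Icc (0 : ℝ) T}

lemma setIntegral_mul_bridgeValue {f : ℝ → ℝ} (hf : Continuous f) (hap : a ≤ p) (hpb : p ≤ b)
    (hbt : b ≤ t) :
    ∫ s in Set.Iic t, f (s : Set.Icc (0 : ℝ) T) * bridgeValue a p b s ∂(timeMeasure T) =
      1 / 2 * ((∫ x in (a : ℝ)..p, f x) - ∫ x in (p : ℝ)..b, f x) := by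
  have hi : Integrable (fun s : Set.Icc (0 : ℝ) T => f s) (timeMeasure T) := by
    obtain ⟨C, hC⟩ := isCompact_univ.exists_bound_of_continuousOn
      (hf.comp continuous_subtype_val : Continuous fun s : Set.Icc (0 : ℝ) T => f s).continuousOn
    exact Integrable.of_bound (hf.measurable.comp measurable_subtype_coe).aestronglyMeasurable C
      (.of_forall fun s => hC s trivial)
  have h1 : ∀ s : Set.Icc (0 : ℝ) T, f s * bridgeValue a p b s =
      (Set.Ioc a p).indicator (fun s : Set.Icc (0 : ℝ) T => 1 / 2 * f s) s -
        (Set.Ioc p b).indicator (fun s : Set.Icc (0 : ℝ) T => 1 / 2 * f s) s := by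
    intro s
    simp only [bridgeValue, SimpleIntegrand.constValue, Fin.sum_univ_two, Matrix.cons_val_zero,
      Matrix.cons_val_one, Set.indicator_apply]
    by_cases h1 : s ∈ Set.Ioc a p <;> by_cases h2 : s ∈ Set.Ioc p b <;>
      simp only [h1, h2, if_true, if_false] <;> ring
  have hi2 := hi.const_mul (1 / 2)
  have hs1 : Set.Iic t ∩ Set.Ioc a p = Set.Ioc a p :=
    Set.inter_eq_right.2 fun s hs => hs.2.trans (hpb.trans hbt)
  have hs2 : Set.Iic t ∩ Set.Ioc p b = Set.Ioc p b :=
    Set.inter_eq_right.2 fun s hs => hs.2.trans hbt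
  simp_rw [h1]
  rw [integral_sub (hi2.restrict.indicator measurableSet_Ioc)
    (hi2.restrict.indicator measurableSet_Ioc), setIntegral_indicator measurableSet_Ioc,
    setIntegral_indicator measurableSet_Ioc, hs1, hs2, integral_const_mul, integral_const_mul,
    setIntegral_Ioc_timeMeasure f hap, setIntegral_Ioc_timeMeasure f hpb]
  ring

lemma setIntegral_bridgeValue_sq (hap : a ≤ p) (hpb : p ≤ b) (hbt : b ≤ t) :
    ∫ s in Set.Iic t, bridgeValue a p b s * bridgeValue a p b s ∂(timeMeasure T) =
      ((b : ℝ) - a) / 4 := by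
  rw [bridgeValue, SimpleIntegrand.setIntegral_constValue_mul_constValue
    (fun i => by fin_cases i <;> simpa) (fun i => by fin_cases i <;> simpa)]
  have hap' : (a : ℝ) ≤ p := hap
  have hpb' : (p : ℝ) ≤ b := hpb
  have hbt' : (b : ℝ) ≤ t := hbt
  simp only [Fin.sum_univ_two, Matrix.cons_val_zero, Matrix.cons_val_one, min_self, max_self]
  rw [min_eq_left hpb', min_eq_right hpb', max_eq_right hap', max_eq_left hap', min_eq_left hbt',
    min_eq_left (hpb'.trans hbt'), max_eq_right (sub_nonneg.2 hap'),
    max_eq_right (sub_nonneg.2 hpb'), sub_self, max_self]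
  ring

lemma abs_bridgeValue_le (s : Set.Icc (0 : ℝ) T) : |bridgeValue a p b s| ≤ 1 := by
  have h : ∀ (A : Set (Set.Icc (0 : ℝ) T)) (x : ℝ), |x| ≤ 1 / 2 →
      |A.indicator (fun _ => x) s| ≤ 1 / 2 := fun A x hx => by
    by_cases hs : s ∈ A
    · simpa [hs] using hx
    · simp [hs]
  simp only [bridgeValue, SimpleIntegrand.constValue, Fin.sum_univ_two, Matrix.cons_val_zero,
    Matrix.cons_val_one]
  refine (abs_add_le _ _).trans ?_
  linarith [h (Set.Ioc a p) (1 / 2) (by norm_num [abs_le]),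
    h (Set.Ioc p b) (-(1 / 2)) (by norm_num [abs_le])]

end BridgeIntegrals

/-! ### Lower bound for the approximation of a Wiener integral by incomplete observations -/

section Core

variable {Ω : Type*} {mΩ : MeasurableSpace Ω} {T : ℝ} {m : ℕ} {P : Measure Ω}
  {𝔽 : Filtration (Set.Icc (0 : ℝ) T) mΩ} {W : Set.Icc (0 : ℝ) T → Ω → EuclideanSpace ℝ (Fin m)}

lemma hasLaw_gaussianReal_of_mem_span (hW : IsStandardBrownianMotion P 𝔽 W)
    [IsProbabilityMeasure P] (hT : 0 ≤ T) {X : Ω → ℝ}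
    (hX : X ∈ Submodule.span ℝ
      (Set.range fun (q : Set.Icc (0 : ℝ) T × Fin m) ω => W q.1 ω q.2)) (h0 : P[X] = 0) :
    HasLaw X (gaussianReal 0 (cov[X, X; P]).toNNReal) P := by
  have h : HasGaussianLaw X P := ((hW.isGaussianProcess hT).of_mem_span
    (Y := fun _ : Unit => X) fun _ => hX).hasGaussianLaw_eval ()
  refine ⟨h.aemeasurable, ?_⟩
  rw [h.map_eq_gaussianReal, h0, covariance_self h.aemeasurable]

/-- `L²` convergence gives almost sure convergence along a subsequence, and dominated convergence
applies because `c` is bounded; no Lipschitz constant of the rapidly oscillating `c` is needed. -/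
lemma exists_subseq_tendsto_lintegral_comp [IsFiniteMeasure P] {J : ℕ → Ω → ℝ} {I : Ω → ℝ}
    (hJ : ∀ k, AEStronglyMeasurable (J k) P) (hI : AEStronglyMeasurable I P)
    (hlim : Tendsto (fun k => ∫⁻ ω, ‖J k ω - I ω‖ₑ ^ 2 ∂P) atTop (𝓝 0))
    {c : ℝ → ℝ} (hc : Continuous c) {D : ℝ} (hD : ∀ x, |c x| ≤ D) :
    ∃ ns : ℕ → ℕ, StrictMono ns ∧
      Tendsto (fun k => ∫⁻ ω, ‖c (J (ns k) ω) - c (I ω)‖ₑ ∂P) atTop (𝓝 0) := by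
  have h1 : Tendsto (fun k => eLpNorm (J k - I) 2 P) atTop (𝓝 0) := by
    have h2 : ∀ k, eLpNorm (J k - I) 2 P = (∫⁻ ω, ‖J k ω - I ω‖ₑ ^ 2 ∂P) ^ (1 / 2 : ℝ) := by
      intro k
      rw [eLpNorm_eq_lintegral_rpow_enorm_toReal two_ne_zero ENNReal.ofNat_ne_top]
      simp
    simp_rw [h2]
    have := ((ENNReal.continuous_rpow_const (y := (1 / 2 : ℝ))).tendsto 0).comp hlim
    simpa [Function.comp_def] using this
  obtain ⟨ns, hns, hae⟩ := (tendstoInMeasure_of_tendsto_eLpNorm two_ne_zero hJ hI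
    h1).exists_seq_tendsto_ae
  refine ⟨ns, hns, ?_⟩
  have h0 : (0 : ℝ≥0∞) = ∫⁻ _, 0 ∂P := by simp
  rw [h0]
  refine tendsto_lintegral_of_dominated_convergence' (fun _ => ENNReal.ofReal (2 * D))
    (fun k => ((hc.comp_aestronglyMeasurable (hJ _)).sub
      (hc.comp_aestronglyMeasurable hI)).enorm) (fun k => .of_forall fun ω => ?_) ?_ ?_
  · simp only [Real.enorm_eq_ofReal_abs]
    apply ENNReal.ofReal_le_ofReal
    linarith [abs_sub (c (J (ns k) ω)) (c (I ω)), hD (J (ns k) ω), hD (I ω)]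
  · simp only [lintegral_const]
    exact ENNReal.mul_ne_top ENNReal.ofReal_ne_top (measure_ne_top _ _)
  · filter_upwards [hae] with ω hω
    simpa using ((((hc.tendsto _).comp hω).sub_const (c (I ω))).enorm)

/-- If `I = ∫ f dW` and `c` oscillates fast enough, then `c I` cannot be approximated by
observations of `W` outside of `(a, b)`. -/
lemma le_lintegral_of_incomplete_observation (hW : IsStandardBrownianMotion P 𝔽 W)
    [IsProbabilityMeasure P] (hT : 0 ≤ T) {τ : ℝ} (hτ : 0 < τ) (hτT : τ ≤ T) {f : ℝ → ℝ}
    (hf : Continuous f) (hf0 : ∀ x, 0 ≤ f x) (hanti : Antitone f) {C : ℝ} (hC : ∀ x, |f x| ≤ C)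
    (hfτ : ∀ x, τ < x → f x = 0) (i : Fin m) {t : Set.Icc (0 : ℝ) T} (ht : ∀ s, s ≤ t)
    (hS : 0 < ∫ x in (0 : ℝ)..T, f x ^ 2) {a p b : Set.Icc (0 : ℝ) T} (hap : a < p) (hpb : p ≤ b)
    (hmid : (p : ℝ) - a = b - p) {v : ℝ} (hv0 : 0 < v)
    (hv : v ≤ (1 / 2 * ((∫ x in (a : ℝ)..p, f x) - ∫ x in (p : ℝ)..b, f x)) ^ 2 /
      (((b : ℝ) - a) / 4))
    {K : Set (Set.Icc (0 : ℝ) T)} (hK : ∀ s ∈ K, s ≤ a ∨ b ≤ s) {U : Ω → ℝ}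
    (hU : Measurable[MeasurableSpace.comap
      (fun ω (q : K × Fin m) => W q.1 ω q.2) MeasurableSpace.pi] U) (hUm : Measurable U)
    {I : Ω → ℝ} (hI : AEStronglyMeasurable I P)
    (hlim : Tendsto (fun k => ∫⁻ ω, ‖(stepIntegrand 𝔽 hT f hτ.le k).integral
      (fun s ω => W s ω i) t ω - I ω‖ₑ ^ 2 ∂P) atTop (𝓝 0))
    {c : ℝ → ℝ} (hc : Continuous c) (hc01 : ∀ x, c x ∈ Set.Icc 0 (1 / 2)) {κ : ℝ}
    (hκ : ∀ v₁ v₂ : ℝ≥0, (∫ x in (0 : ℝ)..T, f x ^ 2) / 4 ≤ v₁ →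
      v₁ ≤ 2 * (∫ x in (0 : ℝ)..T, f x ^ 2) → v / 2 ≤ v₂ →
      v₂ ≤ 2 * (∫ x in (0 : ℝ)..T, f x ^ 2) →
      ENNReal.ofReal κ ≤
        ∫⁻ x, ∫⁻ y, ‖c (x + y) - c (x - y)‖ₑ ∂(gaussianReal 0 v₂) ∂(gaussianReal 0 v₁)) :
    ENNReal.ofReal κ ≤ 2 * ∫⁻ ω, ‖c (I ω) - U ω‖ₑ ∂P := by
  set S := ∫ x in (0 : ℝ)..T, f x ^ 2 with hSdef
  set h := bridgeValue a p b with hh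
  set H : ℝ := ((b : ℝ) - a) / 4 with hH
  have hap' : (a : ℝ) < p := hap
  have hpb' : (p : ℝ) ≤ b := hpb
  have hH0 : 0 < H := by rw [hH]; linarith
  set Ck : ℕ → ℝ := fun k => ∫ s in Set.Iic t, stepValue hT f τ k s * h s ∂(timeMeasure T) with hCk
  set Sk : ℕ → ℝ := fun k => ∫ s in Set.Iic t, stepValue hT f τ k s * stepValue hT f τ k s
    ∂(timeMeasure T) with hSk
  set Cov : ℝ := 1 / 2 * ((∫ x in (a : ℝ)..p, f x) - ∫ x in (p : ℝ)..b, f x) with hCov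
  have htT : (t : ℝ) = T := le_antisymm t.2.2 (ht ⟨T, hT, le_rfl⟩)
  have hCklim : Tendsto Ck atTop (𝓝 Cov) := by
    rw [hCov, ← setIntegral_mul_bridgeValue hf hap.le hpb (ht b)]
    exact tendsto_setIntegral_stepValue_mul hT hτ hτT hf hC hfτ t (g := fun _ => h)
      (fun _ => measurable_constValue _ _ _) (fun _ s _ => abs_bridgeValue_le s)
      (fun _ _ => tendsto_const_nhds)
  have hSklim : Tendsto Sk atTop (𝓝 S) := by
    have h1 : S = ∫ s in Set.Iic t, f (s : Set.Icc (0 : ℝ) T) * f s ∂(timeMeasure T) := by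
      rw [setIntegral_timeMeasure hT (fun s => f s * f s), htT, hSdef]
      refine intervalIntegral.integral_congr fun x hx => ?_
      rw [Set.uIcc_of_le hT] at hx
      simp only [Set.IccExtend_of_mem hT _ hx, sq]
    rw [h1]
    exact tendsto_setIntegral_stepValue_mul hT hτ hτT hf hC hfτ t
      (fun k => measurable_constValue _ _ _) (fun k s hs => abs_stepValue_le hT hτ hτT hC k s hs)
      (fun s hs => tendsto_stepValue hT hτ hτT hf hfτ hs)
  have hvlim : Tendsto (fun k => Ck k ^ 2 / H) atTop (𝓝 (Cov ^ 2 / H)) :=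
    (hCklim.pow 2).div_const H
  have hhalf : Cov ^ 2 / H ≤ S / 2 := by
    refine (bridge_le_half hf hf0 hanti hap' hmid).trans ?_
    gcongr
    exact intervalIntegral.integral_mono_interval a.2.1 hap'.le p.2.2
      (.of_forall fun x => sq_nonneg _) ((hf.pow 2).intervalIntegrable _ _)
  set J : ℕ → Ω → ℝ := fun k => (stepIntegrand 𝔽 hT f hτ.le k).integral (fun s ω => W s ω i) t
    with hJ
  set B : Ω → ℝ := (bridgeIntegrand 𝔽 hap.le hpb).integral (fun s ω => W s ω i) t with hB
  have hBspan : B ∈ Submodule.span ℝ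
      (Set.range fun (q : Set.Icc (0 : ℝ) T × Fin m) ω => W q.1 ω q.2) :=
    SimpleIntegrand.ofConst_integral_mem_span i t
  have hJspan : ∀ k, J k ∈ Submodule.span ℝ
      (Set.range fun (q : Set.Icc (0 : ℝ) T × Fin m) ω => W q.1 ω q.2) := fun k =>
    SimpleIntegrand.ofConst_integral_mem_span i t
  have hBL : MemLp B 2 P := SimpleIntegrand.memLp_integral hW _ i t
  have hJL : ∀ k, MemLp (J k) 2 P := fun k => SimpleIntegrand.memLp_integral hW _ i t
  have hB0 : P[B] = 0 := SimpleIntegrand.integral_integral hW _ i t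
  have hJ0 : ∀ k, P[J k] = 0 := fun k => SimpleIntegrand.integral_integral hW _ i t
  have hBB : cov[B, B; P] = H :=
    ((SimpleIntegrand.covariance_ofConst_integral hW i i t).trans (if_pos rfl)).trans
      (setIntegral_bridgeValue_sq hap.le hpb (ht b))
  have hJB : ∀ k, cov[J k, B; P] = Ck k := fun k =>
    (SimpleIntegrand.covariance_ofConst_integral hW i i t).trans (if_pos rfl)
  have hJJ : ∀ k, cov[J k, J k; P] = Sk k := fun k =>
    (SimpleIntegrand.covariance_ofConst_integral hW i i t).trans (if_pos rfl)
  -- In the limit the variance of `N` is at least `v` and at most `S / 2`, and that of `M` lies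
  -- between `S / 2` and `S`. The weaker bounds in `hκ` leave room for the step approximations.
  have hstep : ∀ᶠ k in atTop, ENNReal.ofReal κ ≤ 2 * ∫⁻ ω, ‖c (J k ω) - U ω‖ₑ ∂P := by
    have e1 : ∀ᶠ k in atTop, v / 2 < Ck k ^ 2 / H :=
      hvlim.eventually_const_lt (by linarith)
    have e2 : ∀ᶠ k in atTop, Ck k ^ 2 / H < 2 * S := hvlim.eventually_lt_const (by linarith)
    have hSv := hSklim.sub hvlim
    have e3 : ∀ᶠ k in atTop, S / 4 < Sk k - Ck k ^ 2 / H :=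
      hSv.eventually_const_lt (by linarith only [hhalf, hS])
    have e4 : ∀ᶠ k in atTop, Sk k - Ck k ^ 2 / H < 2 * S :=
      hSv.eventually_lt_const (by linarith)
    filter_upwards [e1, e2, e3, e4] with k h1 h2 h3 h4
    set l : ℝ := Ck k / H with hl
    set N : Ω → ℝ := fun ω => l * B ω with hN
    -- `l = Cov(J, B) / Var(B)` makes `M` orthogonal to `B`.
    set M : Ω → ℝ := fun ω => J k ω - l * B ω with hM
    have hNspan : N ∈ Submodule.span ℝ
        (Set.range fun (q : Set.Icc (0 : ℝ) T × Fin m) ω => W q.1 ω q.2) :=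
      Submodule.smul_mem _ l hBspan
    have hMspan : M ∈ Submodule.span ℝ
        (Set.range fun (q : Set.Icc (0 : ℝ) T × Fin m) ω => W q.1 ω q.2) :=
      Submodule.sub_mem _ (hJspan k) hNspan
    have hNL : MemLp N 2 P := hBL.const_mul l
    have hN0 : P[N] = 0 := by
      rw [hN, integral_const_mul, hB0, mul_zero]
    have hM0 : P[M] = 0 := by
      rw [hM, integral_sub ((hJL k).integrable one_le_two) (hNL.integrable one_le_two), hJ0, hN0,
        sub_zero]
    have hNN : cov[N, N; P] = Ck k ^ 2 / H := by
      rw [hN, covariance_const_mul_left, covariance_const_mul_right, hBB, hl]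
      field_simp
    have hMM : cov[M, M; P] = Sk k - Ck k ^ 2 / H := by
      change cov[J k - N, J k - N; P] = _
      rw [covariance_sub_left (hJL k) hNL ((hJL k).sub hNL),
        covariance_sub_right (hJL k) (hJL k) hNL, covariance_sub_right hNL (hJL k) hNL,
        hNN, covariance_comm N, hJJ, hN, covariance_const_mul_right, hJB, hl]
      field_simp
      ring
    have hind : IndepFun (fun ω => (U ω, M ω)) B P := by
      refine indepFun_bridge hW hT hap.le hpb hmid i ht hK (κ := l) ?_ hU
      rw [setIntegral_bridgeValue_sq hap.le hpb (ht b), hl, ← hH]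
      exact (div_mul_cancel₀ _ hH0.ne').symm
    have hind' : IndepFun (fun ω => (U ω, M ω)) N P :=
      hind.comp measurable_id (measurable_const_mul l)
    have hNlaw := hasLaw_gaussianReal_of_mem_span hW hT hNspan hN0
    have hMlaw := hasLaw_gaussianReal_of_mem_span hW hT hMspan hM0
    rw [hNN] at hNlaw
    rw [hMM] at hMlaw
    have hc1 : ((Sk k - Ck k ^ 2 / H).toNNReal : ℝ) = Sk k - Ck k ^ 2 / H :=
      Real.coe_toNNReal _ (by linarith)
    have hc2 : ((Ck k ^ 2 / H).toNNReal : ℝ) = Ck k ^ 2 / H :=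
      Real.coe_toNNReal _ (by positivity)
    refine (hκ _ _ (by rw [hc1]; exact h3.le) (by rw [hc1]; exact h4.le) (by rw [hc2]; exact h1.le)
      (by rw [hc2]; exact h2.le)).trans ?_
    refine (lintegral_reflection_le hUm.aemeasurable hMlaw hNlaw hind' hc.measurable).trans_eq ?_
    simp only [hM, hN, sub_add_cancel]
  have hcD : ∀ x, |c x| ≤ 1 / 2 := fun x => by
    rw [abs_of_nonneg (hc01 x).1]
    exact (hc01 x).2
  obtain ⟨ns, hns, hnslim⟩ := exists_subseq_tendsto_lintegral_comp
    (fun k => (hJL k).aestronglyMeasurable) hI hlim hc hcD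
  have hmain : ∀ᶠ k in atTop, ENNReal.ofReal κ ≤
      2 * (∫⁻ ω, ‖c (J (ns k) ω) - c (I ω)‖ₑ ∂P + ∫⁻ ω, ‖c (I ω) - U ω‖ₑ ∂P) := by
    filter_upwards [hns.tendsto_atTop.eventually hstep] with k hk
    refine hk.trans ?_
    gcongr
    rw [← lintegral_add_left']
    · refine lintegral_mono fun ω => ?_
      rw [← sub_add_sub_cancel (c (J (ns k) ω)) (c (I ω)) (U ω)]
      exact enorm_add_le _ _
    · exact ((hc.comp_aestronglyMeasurable (hJL _).aestronglyMeasurable).sub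
        (hc.comp_aestronglyMeasurable hI)).enorm
  have hfin : Tendsto (fun k => 2 * (∫⁻ ω, ‖c (J (ns k) ω) - c (I ω)‖ₑ ∂P +
      ∫⁻ ω, ‖c (I ω) - U ω‖ₑ ∂P)) atTop (𝓝 (2 * (0 + ∫⁻ ω, ‖c (I ω) - U ω‖ₑ ∂P))) :=
    ENNReal.Tendsto.const_mul (hnslim.add_const _) (.inr (by simp))
  rw [zero_add] at hfin
  exact ge_of_tendsto hfin hmain

end Core

/-! ### Path properties of the stochastic differential equation -/

lemma ae_eq_of_tendsto_lintegral {Ω : Type*} {mΩ : MeasurableSpace Ω} {P : Measure Ω}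
    {J : ℕ → Ω → ℝ} {I I' : Ω → ℝ} (hJ : ∀ k, AEMeasurable (J k) P) (hI : AEMeasurable I P)
    (hI' : AEMeasurable I' P) (h : Tendsto (fun k => ∫⁻ ω, ‖J k ω - I ω‖ₑ ^ 2 ∂P) atTop (𝓝 0))
    (h' : Tendsto (fun k => ∫⁻ ω, ‖J k ω - I' ω‖ₑ ^ 2 ∂P) atTop (𝓝 0)) : I =ᵐ[P] I' := by
  have hm : ∀ {A B : Ω → ℝ}, AEMeasurable A P → AEMeasurable B P →
      AEMeasurable (fun ω => ‖A ω - B ω‖ₑ ^ 2) P := fun hA hB => (hA.sub hB).enorm.pow_const 2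
  have hle : ∀ k, ∫⁻ ω, ‖I ω - I' ω‖ₑ ^ 2 ∂P ≤
      2 * ∫⁻ ω, ‖J k ω - I ω‖ₑ ^ 2 ∂P + 2 * ∫⁻ ω, ‖J k ω - I' ω‖ₑ ^ 2 ∂P := by
    intro k
    rw [← lintegral_const_mul'' _ (hm (hJ k) hI), ← lintegral_const_mul'' _ (hm (hJ k) hI'),
      ← lintegral_add_left' ((hm (hJ k) hI).const_mul 2)]
    refine lintegral_mono fun ω => ?_
    simpa only [enorm_sub_rev] using enorm_sub_sq_le (I ω) (I' ω) (J k ω)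
  have hlim := (ENNReal.Tendsto.const_mul (a := 2) h (.inr (by simp))).add
    (ENNReal.Tendsto.const_mul (a := 2) h' (.inr (by simp)))
  simp only [mul_zero, add_zero] at hlim
  have h0 := nonpos_iff_eq_zero.1 (ge_of_tendsto' hlim hle)
  rw [lintegral_eq_zero_iff' (hm hI hI')] at h0
  filter_upwards [h0] with ω hω
  simpa [sub_eq_zero] using hω

lemma IsItoIntegral.ae_eq_zero {Ω : Type*} {mΩ : MeasurableSpace Ω} {T : ℝ} {m : ℕ}
    {P : Measure Ω} [IsProbabilityMeasure P] {𝔽 : Filtration (Set.Icc (0 : ℝ) T) mΩ}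
    {W : Set.Icc (0 : ℝ) T → Ω → EuclideanSpace ℝ (Fin m)} (hW : IsStandardBrownianMotion P 𝔽 W)
    {i : Fin m} {H : Set.Icc (0 : ℝ) T → Ω → ℝ} {t : Set.Icc (0 : ℝ) T} {I : Ω → ℝ}
    (hI : IsItoIntegral P 𝔽 (fun s ω => W s ω i) H t I) (hH : ∀ ω s, H s ω = 0) : I =ᵐ[P] 0 := by
  -- The empty simple integrand approximates zero exactly.
  have h := hI.tendsto_lintegral hW (f := fun _ => 0) measurable_const (.of_forall hH)
    (G := fun _ => .ofConst 𝔽 (n := 0) Fin.elim0 Fin.elim0 (fun i => i.elim0) Fin.elim0)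
    (g := fun _ _ => 0) (fun _ _ _ => by simp [SimpleIntegrand.ofConst_value,
      SimpleIntegrand.constValue]) (by simp)
  refine ae_eq_of_tendsto_lintegral (J := fun _ _ => 0) (fun _ => aemeasurable_const)
    hI.2.1.aestronglyMeasurable.aemeasurable aemeasurable_const ?_ (by simp)
  simpa [SimpleIntegrand.ofConst_integral] using h

lemma ae_forall_eq_of_continuous {Ω K E : Type*} {mΩ : MeasurableSpace Ω} {P : Measure Ω}
    [TopologicalSpace K] [TopologicalSpace.SeparableSpace K] [TopologicalSpace E] [T2Space E]
    {F G : K → Ω → E} (hF : ∀ ω, Continuous fun t => F t ω) (hG : ∀ ω, Continuous fun t => G t ω)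
    (h : ∀ t, F t =ᵐ[P] G t) : ∀ᵐ ω ∂P, ∀ t, F t ω = G t ω := by
  obtain ⟨D, hDc, hDd⟩ := TopologicalSpace.exists_countable_dense K
  filter_upwards [(ae_ball_iff hDc).2 fun t _ => h t] with ω hω t
  exact congrFun (Continuous.ext_on hDd (hF ω) (hG ω) fun s hs => hω s hs) t

section Path

variable {T τ : ℝ} {ρ c : ℝ → ℝ} {y z : Set.Icc (0 : ℝ) T → ℝ}

lemma inv_one_sub_mul_mem_Icc {c r : ℝ} (hc : c ∈ Set.Icc 0 (1 / 2)) (hr : r ∈ Set.Icc 0 1) :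
    (1 - c * r)⁻¹ ∈ Set.Icc 1 2 := by
  have h1 : 0 ≤ c * r := mul_nonneg hc.1 hr.1
  have h2 : c * r ≤ 1 / 2 := by nlinarith [hc.1, hc.2, hr.1, hr.2]
  refine ⟨(one_le_inv₀ (by linarith)).2 (by linarith), ?_⟩
  rw [inv_le_comm₀ (by linarith) two_pos]
  linarith

/-- For a fixed path, `z` is merely a continuous input. The speed lies in `[1, 2]` because `c ≤ 1/2`
and `0 ≤ ρ ≤ 1`; it is `1` while the clock reads at most `τ`, and it depends on `y` alone once `z`
is frozen. -/
lemma path_properties (hT : 0 ≤ T) (hτT : τ ≤ T) (hρ : Continuous ρ)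
    (hρ1 : ∀ x, ρ x ∈ Set.Icc 0 1) (hρτ : ∀ x ≤ τ, ρ x = 0) (hc : Continuous c)
    (hc01 : ∀ x, c x ∈ Set.Icc 0 (1 / 2)) (hy : Continuous y) (hz : Continuous z)
    (heq : ∀ t, y t = ∫ s in Set.Iic t, (1 - c (z s) * ρ (y s))⁻¹ ∂(timeMeasure T)) :
    (∀ t : Set.Icc (0 : ℝ) T, (t : ℝ) ≤ y t) ∧ (∀ t : Set.Icc (0 : ℝ) T, (t : ℝ) ≤ τ → y t = t) ∧
    (∀ t : Set.Icc (0 : ℝ) T, y t ≤ 2 * t) ∧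
    (0 ≤ τ → ∀ e : Set.Icc (0 : ℝ) T, (e : ℝ) = T →
      (∀ t : Set.Icc (0 : ℝ) T, τ ≤ t → z t = z e) →
      y e - c (z e) * (∫ x in τ..y e, ρ x) = T) := by
  set q : ℝ → ℝ := Set.IccExtend hT fun s => (1 - c (z s) * ρ (y s))⁻¹ with hq
  have hqmem : ∀ t, q t ∈ Set.Icc 1 2 := fun t => inv_one_sub_mul_mem_Icc (hc01 _) (hρ1 _)
  have hqc : Continuous q := by
    refine Continuous.Icc_extend' (Continuous.inv₀ (by fun_prop) fun s => ?_)
    have := (inv_one_sub_mul_mem_Icc (hc01 (z s)) (hρ1 (y s))).1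
    intro h0
    rw [h0, inv_zero] at this
    linarith
  set Y : ℝ → ℝ := fun t => ∫ s in (0 : ℝ)..t, q s with hYdef
  have hY : ∀ t, HasDerivAt Y (q t) t := fun t => (hqc.integral_hasStrictDerivAt 0 t).hasDerivAt
  have hY0 : Y 0 = 0 := intervalIntegral.integral_same
  have hyY : ∀ t : Set.Icc (0 : ℝ) T, y t = Y t := fun t => by
    rw [heq, setIntegral_timeMeasure hT]
  have hqv : ∀ t (ht : t ∈ Set.Icc 0 T), q t = (1 - c (z ⟨t, ht⟩) * ρ (Y t))⁻¹ := fun t ht => by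
    rw [hq, Set.IccExtend_of_mem _ _ ht, hyY]
  have hself : ∀ t ∈ Set.Icc 0 τ, Y t = t := fun t ht =>
    eq_self_of_hasDerivAt hY (fun t => (hqmem t).1) hY0 (fun s hs hYs => by
      rw [hqv s ⟨hs.1, hs.2.trans hτT⟩, hρτ _ hYs, mul_zero, sub_zero, inv_one]) ht
  refine ⟨fun t => ?_, fun t ht => ?_, fun t => ?_, fun hτ e he hze => ?_⟩
  · rw [hyY]
    exact le_of_hasDerivAt_one_le hY (fun t => (hqmem t).1) hY0 t.2.1
  · rw [hyY]
    exact hself t ⟨t.2.1, ht⟩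
  · have h := intervalIntegral.integral_mono_on (μ := volume) t.2.1 (hqc.intervalIntegrable 0 t)
      (continuous_const.intervalIntegrable 0 (t : ℝ)) fun x _ => (hqmem x).2
    rw [hyY]
    refine h.trans_eq ?_
    simp [mul_comm]
  · have h := implicit_of_hasDerivAt hY hτT (hself τ ⟨hτ, le_rfl⟩) hρ (c := c (z e))
      (fun x hx => by
        have := (inv_one_sub_mul_mem_Icc (hc01 (z e)) (hρ1 x)).1
        rw [hx, sub_self, inv_zero] at this
        linarith)
      (fun t ht => by rw [hqv t ⟨hτ.trans ht.1, ht.2⟩, hze _ ht.1])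
    rwa [hyY, he]

end Path

/-! ### The coefficients -/

section Coefficients

variable {d m : ℕ} (ξ : EuclideanSpace ℝ (Fin d)) (i₀ i₁ : Fin d) (j₀ : Fin m) (V : ℝ)
  (f ρ c : ℝ → ℝ)

/-- The drift `V / (1 - c (x_{i₁} - ξ_{i₁}) ρ ((x_{i₀} - ξ_{i₀}) / V))` in direction `i₀`. -/
noncomputable def readoutDrift (x : EuclideanSpace ℝ (Fin d)) : EuclideanSpace ℝ (Fin d) :=
  EuclideanSpace.single i₀ (V * (1 - c (x i₁ - ξ i₁) * ρ ((x i₀ - ξ i₀) / V))⁻¹)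

/-- The diffusion coefficient whose only nonzero entry is `f ((x_{i₀} - ξ_{i₀}) / V)`
at `(i₁, j₀)`. -/
noncomputable def clockDiffusion (x : EuclideanSpace ℝ (Fin d)) : Matrix (Fin d) (Fin m) ℝ :=
  Matrix.single i₁ j₀ (f ((x i₀ - ξ i₀) / V))

variable {ξ i₀ i₁ j₀ V f ρ c}

lemma contDiff_readoutDrift {n : ℕ∞} (hρ : ContDiff ℝ n ρ) (hc : ContDiff ℝ n c)
    (hρ1 : ∀ x, ρ x ∈ Set.Icc 0 1) (hc01 : ∀ x, c x ∈ Set.Icc 0 (1 / 2)) :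
    ContDiff ℝ n (readoutDrift ξ i₀ i₁ V ρ c) := by
  have hco : ∀ i : Fin d, ContDiff ℝ n fun x : EuclideanSpace ℝ (Fin d) => x i := fun i =>
    (EuclideanSpace.proj (𝕜 := ℝ) i).contDiff
  have h : ContDiff ℝ n fun x : EuclideanSpace ℝ (Fin d) =>
      V * (1 - c (x i₁ - ξ i₁) * ρ ((x i₀ - ξ i₀) / V))⁻¹ := by
    refine contDiff_const.mul (ContDiff.inv (contDiff_const.sub
      ((hc.comp ((hco i₁).sub contDiff_const)).mul
        (hρ.comp (((hco i₀).sub contDiff_const).div_const V)))) fun x h0 => ?_)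
    have := (inv_one_sub_mul_mem_Icc (hc01 (x i₁ - ξ i₁)) (hρ1 ((x i₀ - ξ i₀) / V))).1
    rw [h0, inv_zero] at this
    linarith
  rw [contDiff_euclidean]
  intro i
  by_cases hi : i = i₀
  · subst hi
    simpa [readoutDrift] using h
  · simpa [readoutDrift, hi] using contDiff_const

lemma norm_readoutDrift_le (hV : 0 ≤ V) (hρ1 : ∀ x, ρ x ∈ Set.Icc 0 1)
    (hc01 : ∀ x, c x ∈ Set.Icc 0 (1 / 2)) (x : EuclideanSpace ℝ (Fin d)) :
    ‖readoutDrift ξ i₀ i₁ V ρ c x‖ ≤ V * 2 := by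
  have h := inv_one_sub_mul_mem_Icc (hc01 (x i₁ - ξ i₁)) (hρ1 ((x i₀ - ξ i₀) / V))
  rw [readoutDrift, PiLp.norm_single, Real.norm_eq_abs, abs_of_nonneg
    (mul_nonneg hV (zero_le_one.trans h.1))]
  exact mul_le_mul_of_nonneg_left h.2 hV

lemma contDiff_clockDiffusion {n : ℕ∞} (hf : ContDiff ℝ n f) (i : Fin d) (j : Fin m) :
    ContDiff ℝ n fun x => clockDiffusion ξ i₀ i₁ j₀ V f x i j := by
  have hco : ContDiff ℝ n fun x : EuclideanSpace ℝ (Fin d) => x i₀ :=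
    (EuclideanSpace.proj (𝕜 := ℝ) i₀).contDiff
  simp only [clockDiffusion, Matrix.single_apply]
  split_ifs
  · exact hf.comp ((hco.sub contDiff_const).div_const V)
  · exact contDiff_const

lemma abs_clockDiffusion_le {C : ℝ} (hf : ∀ x, |f x| ≤ C) (x : EuclideanSpace ℝ (Fin d))
    (i : Fin d) (j : Fin m) : |clockDiffusion ξ i₀ i₁ j₀ V f x i j| ≤ C := by
  simp only [clockDiffusion, Matrix.single_apply]
  split_ifs
  · exact hf _
  · simpa using (abs_nonneg _).trans (hf 0)

end Coefficients

/-! ### Clock, frozen Wiener integral and readout for a solution of the equation -/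

section Solution

variable {Ω : Type*} {mΩ : MeasurableSpace Ω} {T τ : ℝ} {d m : ℕ} {P : Measure Ω}
  {𝔽 : Filtration (Set.Icc (0 : ℝ) T) mΩ} {W : Set.Icc (0 : ℝ) T → Ω → EuclideanSpace ℝ (Fin m)}
  {ξ : EuclideanSpace ℝ (Fin d)} {i₀ i₁ : Fin d} {j₀ : Fin m} {V : ℝ} {f ρ c : ℝ → ℝ}
  {X : Set.Icc (0 : ℝ) T → Ω → EuclideanSpace ℝ (Fin d)}

lemma measurable_apply_of_adapted {E : Type*} [MeasurableSpace E]
    {Z : Set.Icc (0 : ℝ) T → Ω → E} (hZ : Adapted 𝔽 Z) (t : Set.Icc (0 : ℝ) T) :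
    Measurable (Z t) :=
  (hZ t).mono (𝔽.le t) le_rfl

/-- The row `i₀` of the diffusion matrix vanishes, so this coordinate solves a pathwise integral
equation. Continuity of both sides gives one null set for all times. -/
lemma ae_clock_equation [IsProbabilityMeasure P] (hW : IsStandardBrownianMotion P 𝔽 W)
    (hX : IsSDESolution P 𝔽 W ξ (readoutDrift ξ i₀ i₁ V ρ c) (clockDiffusion ξ i₀ i₁ j₀ V f) X)
    (hi : i₀ ≠ i₁) (hV : V ≠ 0) (hρ : Continuous ρ) (hc : Continuous c)
    (hρ1 : ∀ x, ρ x ∈ Set.Icc 0 1) (hc01 : ∀ x, c x ∈ Set.Icc 0 (1 / 2)) (hT : 0 ≤ T) :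
    ∀ᵐ ω ∂P, ∀ t, (X t ω i₀ - ξ i₀) / V = ∫ s in Set.Iic t,
      (1 - c (X s ω i₁ - ξ i₁) * ρ ((X s ω i₀ - ξ i₀) / V))⁻¹ ∂(timeMeasure T) := by
  have hco : ∀ ω i, Continuous fun t => X t ω i := fun ω i =>
    (EuclideanSpace.proj (𝕜 := ℝ) i).continuous.comp (hX.continuous ω)
  refine ae_forall_eq_of_continuous
    (fun ω => ((hco ω i₀).sub continuous_const).div_const V) (fun ω => ?_) fun t => ?_
  · have hq : Continuous fun s : Set.Icc (0 : ℝ) T =>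
        (1 - c (X s ω i₁ - ξ i₁) * ρ ((X s ω i₀ - ξ i₀) / V))⁻¹ := by
      refine Continuous.inv₀ (continuous_const.sub ((hc.comp ((hco ω i₁).sub
        continuous_const)).mul (hρ.comp (((hco ω i₀).sub continuous_const).div_const V))))
        fun s h0 => ?_
      have := (inv_one_sub_mul_mem_Icc (hc01 (X s ω i₁ - ξ i₁))
        (hρ1 ((X s ω i₀ - ξ i₀) / V))).1
      rw [h0, inv_zero] at this
      linarith
    simp_rw [setIntegral_timeMeasure hT]
    exact (intervalIntegral.continuous_primitive
      (fun a b => (hq.Icc_extend' (h := hT)).intervalIntegrable a b) 0).comp continuous_subtype_val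
  · obtain ⟨I, hI, hXt⟩ := hX.equation t
    have h0 : ∀ᵐ ω ∂P, ∀ j, I i₀ j ω = 0 := ae_all_iff.2 fun j =>
      (hI i₀ j).ae_eq_zero hW fun ω s => by simp [clockDiffusion, hi.symm]
    filter_upwards [hXt, h0] with ω h1 h2
    rw [h1 i₀, Finset.sum_eq_zero fun j _ => h2 j]
    simp only [readoutDrift, PiLp.single_apply, if_true]
    rw [integral_const_mul]
    field_simp
    ring

/-- The end point of the solution determines `c (∫ f dW)`. -/
lemma solution_readout [IsProbabilityMeasure P] (hW : IsStandardBrownianMotion P 𝔽 W)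
    (hX : IsSDESolution P 𝔽 W ξ (readoutDrift ξ i₀ i₁ V ρ c) (clockDiffusion ξ i₀ i₁ j₀ V f) X)
    (hi : i₀ ≠ i₁) (hV : V ≠ 0) (hρ : Continuous ρ) (hc : Continuous c)
    (hρ1 : ∀ x, ρ x ∈ Set.Icc 0 1) (hρτ : ∀ x ≤ τ, ρ x = 0)
    (hc01 : ∀ x, c x ∈ Set.Icc 0 (1 / 2)) (hT : 0 ≤ T) (hτ : 0 < τ) (hτT : τ ≤ T)
    (hf : Continuous f) {C : ℝ} (hC : ∀ x, |f x| ≤ C) (hfτ : ∀ x, τ < x → f x = 0)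
    {e : Set.Icc (0 : ℝ) T} (he : (e : ℝ) = T) :
    (∀ᵐ ω ∂P, T ≤ (X e ω i₀ - ξ i₀) / V ∧ (X e ω i₀ - ξ i₀) / V ≤ 2 * T ∧
      (X e ω i₀ - ξ i₀) / V -
        c (X e ω i₁ - ξ i₁) * (∫ x in τ..(X e ω i₀ - ξ i₀) / V, ρ x) = T) ∧
    Tendsto (fun k => ∫⁻ ω, ‖(stepIntegrand 𝔽 hT f hτ.le k).integral
      (fun s ω => W s ω j₀) e ω - (X e ω i₁ - ξ i₁)‖ₑ ^ 2 ∂P) atTop (𝓝 0) := by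
  have hco : ∀ ω i, Continuous fun t => X t ω i := fun ω i =>
    (EuclideanSpace.proj (𝕜 := ℝ) i).continuous.comp (hX.continuous ω)
  have hmeas : ∀ t, Measurable fun ω => X t ω i₁ - ξ i₁ := fun t =>
    ((EuclideanSpace.proj (𝕜 := ℝ) i₁).continuous.sub
      (continuous_const (y := ξ i₁))).measurable.comp (measurable_apply_of_adapted hX.adapted t)
  have hclock := ae_clock_equation hW hX hi hV hρ hc hρ1 hc01 hT
  have hprop : ∀ᵐ ω ∂P, _ := hclock.mono fun ω hω =>
    path_properties (y := fun t => (X t ω i₀ - ξ i₀) / V) (z := fun t => X t ω i₁ - ξ i₁)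
      hT hτT hρ hρ1 hρτ hc hc01 (((hco ω i₀).sub continuous_const).div_const V)
      ((hco ω i₁).sub continuous_const) hω
  -- Up to `τ` the clock shows the true time; afterwards both the clock and the time exceed `τ`,
  -- where `f` vanishes. The integrand is thus deterministic.
  have hclockf : ∀ᵐ ω ∂P, ∀ s : Set.Icc (0 : ℝ) T, f ((X s ω i₀ - ξ i₀) / V) = f s := by
    filter_upwards [hprop] with ω hω s
    rcases le_or_gt (s : ℝ) τ with h | h
    · rw [hω.2.1 s h]
    · rw [hfτ _ h, hfτ _ (h.trans_le (hω.1 s))]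
  have hlim : ∀ t, Tendsto (fun k => ∫⁻ ω, ‖(stepIntegrand 𝔽 hT f hτ.le k).integral
      (fun s ω => W s ω j₀) t ω - (X t ω i₁ - ξ i₁)‖ₑ ^ 2 ∂P) atTop (𝓝 0) := by
    intro t
    obtain ⟨I, hI, hXt⟩ := hX.equation t
    have h0 : ∀ᵐ ω ∂P, ∀ j, j ≠ j₀ → I i₁ j ω = 0 := ae_all_iff.2 fun j => by
      by_cases hj : j = j₀
      · exact .of_forall fun _ h => absurd hj h
      · filter_upwards [(hI i₁ j).ae_eq_zero hW fun ω s => by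
          simp [clockDiffusion, Ne.symm hj]] with ω hω _ using hω
    have hae : ∀ᵐ ω ∂P, X t ω i₁ - ξ i₁ = I i₁ j₀ ω := by
      filter_upwards [hXt, h0] with ω h1 h2
      rw [h1 i₁, Finset.sum_eq_single j₀ (fun j _ hj => h2 j hj) (by simp)]
      simp [readoutDrift, hi.symm]
    have h := (hI i₁ j₀).tendsto_lintegral hW (f := fun s => f s)
      (hf.measurable.comp measurable_subtype_coe)
      (hclockf.mono fun ω hω s => by simpa [clockDiffusion] using hω s)
      (G := fun k => stepIntegrand 𝔽 hT f hτ.le k) (g := fun k => stepValue hT f τ k)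
      (fun _ _ _ => rfl) (tendsto_lintegral_stepValue hT hτ hτT hf hC hfτ t)
    refine h.congr fun k => lintegral_congr_ae ?_
    filter_upwards [hae] with ω hω
    rw [hω]
  -- At any two times from `τ` on, the elementary integrals coincide, hence so do their `L²` limits;
  -- continuity makes this simultaneous in `t`.
  have hconst : ∀ᵐ ω ∂P, ∀ t : {t : Set.Icc (0 : ℝ) T // τ ≤ t}, X t ω i₁ = X e ω i₁ := by
    refine ae_forall_eq_of_continuous (F := fun (t : {t : Set.Icc (0 : ℝ) T // τ ≤ t}) ω =>
      X t ω i₁) (G := fun _ ω => X e ω i₁) (fun ω => (hco ω i₁).comp continuous_subtype_val)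
      (fun _ => continuous_const) fun t => ?_
    have h := ae_eq_of_tendsto_lintegral (P := P)
      (J := fun k => (stepIntegrand 𝔽 hT f hτ.le k).integral (fun s ω => W s ω j₀) e)
      (I := fun ω => X t ω i₁ - ξ i₁) (I' := fun ω => X e ω i₁ - ξ i₁)
      (fun k => (SimpleIntegrand.memLp_integral hW _ j₀ e).aestronglyMeasurable.aemeasurable)
      (hmeas _).aemeasurable (hmeas _).aemeasurable
      ((hlim t).congr fun k => lintegral_congr fun ω => by
        rw [stepIntegrand_integral_eq hT hτ.le hτT k _ t.2,
          stepIntegrand_integral_eq hT hτ.le hτT k _ (hτT.trans_eq he.symm)]) (hlim e)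
    filter_upwards [h] with ω hω using sub_left_inj.1 hω
  refine ⟨?_, hlim e⟩
  filter_upwards [hprop, hconst] with ω h1 h2
  refine ⟨he.symm.trans_le (h1.1 e), (h1.2.2.1 e).trans_eq (by rw [he]), ?_⟩
  exact h1.2.2.2 hτ.le e he fun t ht => by
    simp only [h2 ⟨t, ht⟩]

end Solution

/-! ### Choice of the profiles and conclusion -/

lemma expNegInvGlue_le_one (x : ℝ) : expNegInvGlue x ≤ 1 := by
  rcases le_or_gt x 0 with h | h
  · rw [expNegInvGlue.zero_of_nonpos h]
    exact zero_le_one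
  · rw [expNegInvGlue, if_neg h.not_ge, Real.exp_le_one_iff]
    simpa using h.le

lemma strictMonoOn_expNegInvGlue : StrictMonoOn expNegInvGlue (Set.Ici 0) := by
  intro x hx y hy hxy
  have hy0 : 0 < y := lt_of_le_of_lt hx hxy
  rcases (Set.mem_Ici.1 hx).eq_or_lt with h | h
  · rw [← h, expNegInvGlue.zero]
    exact expNegInvGlue.pos_of_pos hy0
  · rw [expNegInvGlue, expNegInvGlue, if_neg h.not_ge, if_neg hy0.not_ge, Real.exp_lt_exp,
      neg_lt_neg_iff]
    exact (inv_lt_inv₀ hy0 h).2 hxy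

lemma strictAntiOn_expNegInvGlue_sub (τ : ℝ) :
    StrictAntiOn (fun s => expNegInvGlue (τ - s)) (Set.Iic τ) := fun x hx y hy hxy =>
  strictMonoOn_expNegInvGlue (Set.mem_Ici.2 (sub_nonneg.2 hy)) (Set.mem_Ici.2 (sub_nonneg.2 hx))
    (by linarith)

lemma isCompact_observationTimes (T a b : ℝ) : IsCompact (observationTimes T a b) :=
  ((isClosed_Icc.union isClosed_Icc).preimage continuous_subtype_val).isCompact

/-- Links the Borel σ-algebra of uniform convergence, for which estimators are measurable, with the
one generated by the coordinates of `W`, for which independence is known. -/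
lemma measurable_restrict_path {Ω : Type*} {T : ℝ} {m : ℕ}
    {W : Set.Icc (0 : ℝ) T → Ω → EuclideanSpace ℝ (Fin m)} (hW : ∀ ω, Continuous fun t => W t ω)
    {K : Set (Set.Icc (0 : ℝ) T)} (hK : IsCompact K) :
    Measurable[MeasurableSpace.comap (fun ω (q : K × Fin m) => W q.1 ω q.2) MeasurableSpace.pi,
      borel C(K, EuclideanSpace ℝ (Fin m))]
      fun ω => (⟨fun t => W t ω, hW ω⟩ :
        C(Set.Icc (0 : ℝ) T, EuclideanSpace ℝ (Fin m))).restrict K := by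
  have := isCompact_iff_compactSpace.1 hK
  let _ : MeasurableSpace Ω :=
    MeasurableSpace.comap (fun ω (q : K × Fin m) => W q.1 ω q.2) MeasurableSpace.pi
  refine measurable_continuousMap_of_eval fun t => ?_
  refine (WithLp.measurable_toLp 2 (Fin m → ℝ)).comp
    (g := WithLp.toLp 2) (f := fun ω j => W t ω j) (measurable_pi_lambda _ fun j => ?_)
  exact (measurable_pi_apply (X := fun _ : K × Fin m => ℝ) (t, j)).comp (comap_measurable _)

theorem theorem3p21 (T : ℝ) (hT : 0 < T) (τ : ℝ) (hτ : τ ∈ Set.Ioo 0 T)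
    (d : ℕ) (hd : 2 ≤ d) (ξ : EuclideanSpace ℝ (Fin d)) (m : ℕ) (hm : 1 ≤ m)
    (ε δ : ℕ → ℝ) (hε : ∀ n, 1 ≤ n → ε n ∈ Set.Ioc 0 τ)
    (hδ : limsup (fun n => (δ n : EReal)) atTop ≤ 0) :
    ∃ (μ : EuclideanSpace ℝ (Fin d) → EuclideanSpace ℝ (Fin d))
      (σ : EuclideanSpace ℝ (Fin d) → Matrix (Fin d) (Fin m) ℝ),
      ContDiff ℝ (⊤ : ℕ∞) μ ∧ (∀ i j, ContDiff ℝ (⊤ : ℕ∞) fun x => σ x i j) ∧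
      (∃ C : ℝ, ∀ x, ‖μ x‖ ≤ C) ∧ (∃ C : ℝ, ∀ x i j, |σ x i j| ≤ C) ∧
      ∀ (Ω : Type*) (mΩ : MeasurableSpace Ω) (P : Measure Ω) (_ : IsProbabilityMeasure P)
        (𝔽 : Filtration (Set.Icc (0 : ℝ) T) mΩ) (_ : IsNormalFiltration P 𝔽)
        (W : Set.Icc (0 : ℝ) T → Ω → EuclideanSpace ℝ (Fin m))
        (hW : IsStandardBrownianMotion P 𝔽 W)
        (X : Set.Icc (0 : ℝ) T → Ω → EuclideanSpace ℝ (Fin d))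
        (_ : IsSDESolution P 𝔽 W ξ μ σ X) (n : ℕ), 1 ≤ n →
        ENNReal.ofReal (δ n) ≤
          ⨅ (a ∈ Set.Icc 0 τ) (b ∈ Set.Icc 0 τ) (_ : ε n ≤ b - a)
            (u : C(observationTimes T a b, EuclideanSpace ℝ (Fin m)) → ℝ)
            (_ : Measurable[borel _] u),
            ∫⁻ ω, ENNReal.ofReal |X ⟨T, hT.le, le_rfl⟩ ω ⟨0, lt_of_lt_of_le two_pos hd⟩ -
              u ((⟨fun t => W t ω, hW.continuous ω⟩ :
                C(Set.Icc (0 : ℝ) T, EuclideanSpace ℝ (Fin m))).restrict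
                  (observationTimes T a b))| ∂P := by
  have hτ0 : 0 < τ := hτ.1
  have hτT : τ < T := hτ.2
  set i₀ : Fin d := ⟨0, lt_of_lt_of_le two_pos hd⟩ with hi₀
  set i₁ : Fin d := ⟨1, lt_of_lt_of_le one_lt_two hd⟩ with hi₁
  set j₀ : Fin m := ⟨0, hm⟩
  have hi : i₀ ≠ i₁ := by simp [hi₀, hi₁]
  set f : ℝ → ℝ := fun s => expNegInvGlue (τ - s) with hf
  set ρ : ℝ → ℝ := fun y => expNegInvGlue (y - τ) with hρ
  have hfs : ContDiff ℝ (⊤ : ℕ∞) f := expNegInvGlue.contDiff.comp (contDiff_const.sub contDiff_id)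
  have hρs : ContDiff ℝ (⊤ : ℕ∞) ρ := expNegInvGlue.contDiff.comp (contDiff_id.sub contDiff_const)
  have hf0 : ∀ x, 0 ≤ f x := fun x => expNegInvGlue.nonneg _
  have hf1 : ∀ x, |f x| ≤ 1 := fun x => by
    rw [abs_of_nonneg (hf0 x)]
    exact expNegInvGlue_le_one _
  have hfanti : Antitone f := fun x y hxy => expNegInvGlue.monotone (by linarith)
  have hfstrict : StrictAntiOn f (Set.Icc 0 τ) :=
    (strictAntiOn_expNegInvGlue_sub τ).mono Set.Icc_subset_Iic_self
  have hfτ : ∀ x, τ < x → f x = 0 := fun x hx => expNegInvGlue.zero_of_nonpos (by linarith)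
  have hρ1 : ∀ x, ρ x ∈ Set.Icc 0 1 := fun x => ⟨expNegInvGlue.nonneg _, expNegInvGlue_le_one _⟩
  have hρτ : ∀ x ≤ τ, ρ x = 0 := fun x hx => expNegInvGlue.zero_of_nonpos (by linarith)
  have hR : 0 < ∫ x in τ..T, ρ x :=
    intervalIntegral.intervalIntegral_pos_of_pos_on (hρs.continuous.intervalIntegrable _ _)
      (fun x hx => expNegInvGlue.pos_of_pos (sub_pos.2 hx.1)) hτT
  have hf2 : ∀ a b, IntervalIntegrable (fun x => f x ^ 2) volume a b := fun a b =>
    (hfs.continuous.pow 2).intervalIntegrable a b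
  have hS : 0 < ∫ x in (0 : ℝ)..T, f x ^ 2 :=
    (intervalIntegral.intervalIntegral_pos_of_pos_on (hf2 0 τ)
      (fun x hx => pow_pos (expNegInvGlue.pos_of_pos (sub_pos.2 hx.2)) 2) hτ0).trans_le
      (intervalIntegral.integral_mono_interval le_rfl hτ0.le hτT.le
        (.of_forall fun x => sq_nonneg _) (hf2 0 T))
  obtain ⟨κ, hκ0, hκ⟩ := exists_le_lintegral_oscillation hS
  obtain ⟨A, hA, K, hKδ, hKfin⟩ := exists_selection hδ hκ0
  obtain ⟨L, hL, Θ, hΘ, hLΘ⟩ := exists_lipschitz_readout hρs.continuous (fun x => (hρ1 x).1)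
    (fun x => (hρ1 x).2) hT hR
  -- The index `0` carries no assumption on `ε` and receives the dummy value `1`.
  have hv : ∀ n, ∃ v > 0, 1 ≤ n → ∀ a p b : ℝ, 0 ≤ a → b ≤ τ → ε n ≤ b - a → p - a = b - p →
      v ≤ (1 / 2 * ((∫ x in a..p, f x) - ∫ x in p..b, f x)) ^ 2 / ((b - a) / 4) := by
    intro n
    by_cases hn : 1 ≤ n
    · obtain ⟨v, hv0, hv⟩ := exists_le_bridge hfs.continuous hfanti hfstrict (hε n hn)
      exact ⟨v, hv0, fun _ a p b ha hb hab hmid => (hv a p b ha hb hab hmid).2⟩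
    · exact ⟨1, one_pos, fun h => absurd h hn⟩
  choose v hv0 hv using hv
  -- Each band serves finitely many `n`, so one frequency per band exceeds all thresholds required
  -- by `hκ` with `v₀ = v n / 2`.
  obtain ⟨w, hw⟩ := exists_majorant_of_finite_fibers hKfin fun n => 2 / min √(v n / 2) (1 / 8)
  obtain ⟨c, hcs, hc01, hcw⟩ := exists_contDiff_oscillation w
  have hV : 0 < 2 * L * A := by positivity
  -- The scale `2 L A` compensates the Lipschitz constant `L` of the readout, the factor `2` of the
  -- reflection and the amplitude `A` of the selection.
  refine ⟨readoutDrift ξ i₀ i₁ (2 * L * A) ρ c, clockDiffusion ξ i₀ i₁ j₀ (2 * L * A) f,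
    contDiff_readoutDrift hρs hcs hρ1 hc01, fun i j => contDiff_clockDiffusion hfs i j,
    ⟨_, norm_readoutDrift_le hV.le hρ1 hc01⟩, ⟨1, fun x i j => abs_clockDiffusion_le hf1 x i j⟩, ?_⟩
  intro Ω mΩ P _ 𝔽 _ W hW X hX n hn
  set e : Set.Icc (0 : ℝ) T := ⟨T, hT.le, le_rfl⟩ with he
  obtain ⟨hread, hlim⟩ := solution_readout hW hX hi hV.ne' hρs.continuous hcs.continuous hρ1 hρτ
    hc01 hT.le hτ0 hτT.le hfs.continuous hf1 hfτ (e := e) rfl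
  refine le_iInf₂ fun a ha => le_iInf₂ fun b hb => le_iInf fun hab => le_iInf₂ fun u hu => ?_
  have hεn := (hε n hn).1
  set O : Ω → C(observationTimes T a b, EuclideanSpace ℝ (Fin m)) := fun ω =>
    (⟨fun t => W t ω, hW.continuous ω⟩ :
      C(Set.Icc (0 : ℝ) T, EuclideanSpace ℝ (Fin m))).restrict (observationTimes T a b) with hO
  -- The readout turns an estimator of the end point into an estimator of `c` at the Wiener
  -- integral, based on the same observations.
  set U : Ω → ℝ := fun ω => Θ ((u (O ω) - ξ i₀) / (2 * L * A)) with hU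
  have hUm : Measurable[MeasurableSpace.comap (fun ω (q : observationTimes T a b × Fin m) =>
      W q.1 ω q.2) MeasurableSpace.pi] U :=
    (hΘ.comp ((measurable_id.sub_const (ξ i₀)).div_const (2 * L * A))).comp
      (hu.comp (measurable_restrict_path hW.continuous (isCompact_observationTimes T a b)))
  have hcoord : ∀ t i, Measurable fun ω => W t ω i := fun t i =>
    (EuclideanSpace.proj (𝕜 := ℝ) i).continuous.measurable.comp
      (measurable_apply_of_adapted hW.adapted t)
  have hcomap : MeasurableSpace.comap (fun ω (q : observationTimes T a b × Fin m) =>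
      W q.1 ω q.2) MeasurableSpace.pi ≤ mΩ :=
    (measurable_pi_lambda _ fun (q : observationTimes T a b × Fin m) => hcoord q.1 q.2).comap_le
  have hIm : Measurable fun ω => X e ω i₁ - ξ i₁ :=
    ((EuclideanSpace.proj (𝕜 := ℝ) i₁).continuous.sub
      (continuous_const (y := ξ i₁))).measurable.comp (measurable_apply_of_adapted hX.adapted e)
  have hcore := le_lintegral_of_incomplete_observation hW hT.le hτ0 hτT.le hfs.continuous hf0
    hfanti hf1 hfτ j₀ (t := e) (fun s => s.2.2) hS
    (a := ⟨a, ha.1, ha.2.trans hτT.le⟩)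
    (p := ⟨(a + b) / 2, by linarith [ha.1, hb.1], by linarith [ha.2, hb.2]⟩)
    (b := ⟨b, hb.1, hb.2.trans hτT.le⟩)
    (show a < (a + b) / 2 by linarith) (show (a + b) / 2 ≤ b by linarith)
    (show (a + b) / 2 - a = b - (a + b) / 2 by ring) (hv0 n)
    (hv n hn a ((a + b) / 2) b ha.1 hb.2 hab (by ring)) (K := observationTimes T a b)
    (fun s hs => hs.imp (fun h => h.2) fun h => h.1) hUm (hUm.mono hcomap le_rfl)
    hIm.aestronglyMeasurable hlim hcs.continuous hc01 (κ := κ (K n))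
    fun v₁ v₂ h1 h2 h3 h4 => hκ (K n) (v n / 2) (w (K n)) (half_pos (hv0 n)) (hw n) c
      hcs.continuous.measurable (hcw (K n)) v₁ v₂ h1 h2 h3 h4
  calc ENNReal.ofReal (δ n) ≤ ENNReal.ofReal (A * κ (K n)) := ENNReal.ofReal_le_ofReal (hKδ n)
    _ = ENNReal.ofReal A * ENNReal.ofReal (κ (K n)) := ENNReal.ofReal_mul hA.le
    _ ≤ ENNReal.ofReal A * (2 * ∫⁻ ω, ‖c (X e ω i₁ - ξ i₁) - U ω‖ₑ ∂P) := by gcongr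
    _ = ENNReal.ofReal (2 * A) * ∫⁻ ω, ‖c (X e ω i₁ - ξ i₁) - U ω‖ₑ ∂P := by
      rw [← mul_assoc, mul_comm (ENNReal.ofReal A), ENNReal.ofReal_mul two_pos.le,
        ENNReal.ofReal_ofNat]
    _ ≤ ∫⁻ ω, ENNReal.ofReal (2 * A) * ‖c (X e ω i₁ - ξ i₁) - U ω‖ₑ ∂P :=
      lintegral_const_mul_le _ _
    _ ≤ ∫⁻ ω, ENNReal.ofReal |X e ω i₀ - u (O ω)| ∂P := by
      refine lintegral_mono_ae ?_
      filter_upwards [hread] with ω hω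
      rw [Real.enorm_eq_ofReal_abs, ← ENNReal.ofReal_mul (by positivity)]
      refine ENNReal.ofReal_le_ofReal ?_
      have h := hLΘ _ _ hω.1 hω.2.1 hω.2.2 ((u (O ω) - ξ i₀) / (2 * L * A))
      rw [← sub_div, sub_sub_sub_cancel_right, abs_div, abs_of_pos hV] at h
      calc 2 * A * |c (X e ω i₁ - ξ i₁) - U ω|
          ≤ 2 * A * (L * (|X e ω i₀ - u (O ω)| / (2 * L * A))) := by gcongr
        _ = |X e ω i₀ - u (O ω)| := by field_simp
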